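/- Let $X$ be a complex Banach space and let $A$ be a linear operator in $X$ with domain $D(A)\subset X$ (for example the generator of an analytic semigroup). For some $\vartheta>\pi/2$ suppose that the sector $\Sigma_\vartheta=\{z\in\mathbb C\setminus\{0\}:|\arg z|<\vartheta\}$ is contained in the resolvent set of $A$ and that the operators $A(\lambda-A)^{-1}$ are bounded on $X$ uniformly for $\lambda\in\Sigma_\vartheta$. Consider an $s$-stage Runge--Kutta method with real coefficient matrix $\mathcal A=(a_{ij})$, weights $b=(b_i)$ and nodes $c=(c_i)$, and stability function $R(z)=1+z\,b^T(I-z\mathcal A)^{-1}\mathbf 1$, where $\mathbf 1=(1,\dots,1)^T$. Suppose that - $R(z)=e^z+O(z^2)$ as $z\to0$; - the method is A-stable, that is, $I-z\mathcal A$ is nonsingular and $|R(z)|\le1$ for all $z\in\mathbb C$ with $\operatorname{Re}z\le0$; - $\mathcal A$ is invertible, and $|R(\infty)|<1$, where $R(\infty)=1-b^T\mathcal A^{-1}\mathbf 1=\lim_{|z|\to\infty}R(z)$. For a stepsize $\tau>0$, a function $f$ with values in $X$, $t_n=n\tau$ and $F_n=(f(t_n+c_i\tau))_{i=1}^s\in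 X^s$, the numerical solution of $u'=Au+f$, $u(0)=0$, is given by $u_0=0$ and, for $n\ge0$, by $$U_{ni}=u_n+\tau\sum_{j=1}^s a_{ij}\dot U_{nj},\qquad u_{n+1}=u_n+\tau\sum_{i=1}^s b_i\dot U_{ni},\qquad \dot U_{ni}=AU_{ni}+f(t_n+c_i\tau)\qquad(i=1,\dots,s),$$ with $U_{ni}\in D(A)$; write $U_n=(U_{ni})_{i=1}^s$ and $AU_n=(AU_{ni})_{i=1}^s$. Then there is a constant $C$, independent of $\tau>0$, $f$, $N$ and $p$, such that for all $\tau>0$ and all $f$ the numerical solution exists and is unique, $u_n\in D(A)$ for all $n\ge0$, and for all integers $N\ge2$ and all $1\le p\le\infty$ $$\|(Au_{n+1})_{n=0}^{N-1}\|_{\ell^p(X)}+\|(AU_n)_{n=0}^{N-1}\|_{\ell^p(X^s)}\le C\,\log N\,\|(F_n)_{n=0}^{N-1}\|_{\ell^p(X^s)},$$ where $X^s$ carries the norm $\max_i\|x_i\|_X$. -/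

import Mathlib

open scoped ENNReal Topology Matrix

noncomputable section

/-- The coefficients of a Runge--Kutta method with `s` stages (its Butcher tableau). -/
structure ButcherTableau (s : ℕ) where
  /-- the coefficient matrix -/
  a : Matrix (Fin s) (Fin s) ℝ
  /-- the weights -/
  b : Fin s → ℝ
  /-- the nodes -/
  c : Fin s → ℝ

namespace ButcherTableau

variable {s : ℕ}

/-- The coefficient matrix with complex entries. -/
def aC (T : ButcherTableau s) : Matrix (Fin s) (Fin s) ℂ :=
  T.a.map Complex.ofReal

/-- The weights with complex entries. -/
def bC (T : ButcherTableau s) : Fin s → ℂ :=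
  fun i => (T.b i : ℂ)

/-- The stability function `R(z) = 1 + z bᵀ (I - z a)⁻¹ 𝟙`. -/
def stab (T : ButcherTableau s) (z : ℂ) : ℂ :=
  1 + z * (T.bC ⬝ᵥ ((1 - z • T.aC)⁻¹ *ᵥ fun _ => 1))

/-- The value `R(∞) = 1 - bᵀ a⁻¹ 𝟙` of the stability function at infinity, for a method with
invertible coefficient matrix. -/
def stabInfty (T : ButcherTableau s) : ℂ :=
  1 - T.bC ⬝ᵥ (T.aC⁻¹ *ᵥ fun _ => 1)

/-- A-stability: `I - z a` is nonsingular and `|R(z)| ≤ 1` for `Re z ≤ 0`. -/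
def IsAStable (T : ButcherTableau s) : Prop :=
  ∀ z : ℂ, z.re ≤ 0 → IsUnit (1 - z • T.aC).det ∧ ‖T.stab z‖ ≤ 1

/-- The stability function approximates the exponential to order at least one:
`R(z) = e^z + O(z^2)` as `z → 0`. -/
def HasOrderAtLeastOne (T : ButcherTableau s) : Prop :=
  (fun z : ℂ => T.stab z - Complex.exp z) =O[𝓝 0] fun z : ℂ => z ^ 2

/-- `stabInfty` is indeed the limit of the stability function at infinity. -/
theorem tendsto_stab_stabInfty (T : ButcherTableau s) (h : IsUnit T.a.det) :
    Filter.Tendsto T.stab (Filter.cocompact ℂ) (𝓝 T.stabInfty) := by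
  have hdet : T.aC.det ≠ 0 := by
    have : T.aC.det = ((T.a.det : ℝ) : ℂ) := by
      exact (RingHom.map_det Complex.ofRealHom T.a).symm
    rw [this]
    exact_mod_cast h.ne_zero
  have h0 : Filter.Tendsto (fun z : ℂ => z⁻¹) (Filter.cocompact ℂ) (𝓝 0) :=
    Filter.tendsto_inv₀_cobounded.comp (by rw [Metric.cobounded_eq_cocompact]; exact Filter.tendsto_id)
  have hc : ContinuousAt
      (fun w : ℂ => 1 + T.bC ⬝ᵥ ((w • (1 : Matrix (Fin s) (Fin s) ℂ) - T.aC)⁻¹ *ᵥ fun _ => 1)) 0 := by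
    have h1 : ContinuousAt (fun w : ℂ => (w • (1 : Matrix (Fin s) (Fin s) ℂ) - T.aC)⁻¹) 0 := by
      have hd : ContinuousAt (fun w : ℂ => w • (1 : Matrix (Fin s) (Fin s) ℂ) - T.aC) 0 := by
        fun_prop
      have hne : ((0 : ℂ) • (1 : Matrix (Fin s) (Fin s) ℂ) - T.aC).det ≠ 0 := by
        rw [zero_smul, zero_sub, Matrix.det_neg]
        exact mul_ne_zero (pow_ne_zero _ (by norm_num)) hdet
      simp only [Matrix.inv_def]
      refine ContinuousAt.smul (f := fun w : ℂ => Ring.inverse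
        (w • (1 : Matrix (Fin s) (Fin s) ℂ) - T.aC).det) ?_ ?_
      · simp only [Ring.inverse_eq_inv']
        exact ContinuousAt.inv₀ (by fun_prop) hne
      · fun_prop
    have h2 : Continuous fun B : Matrix (Fin s) (Fin s) ℂ =>
        1 + T.bC ⬝ᵥ (B *ᵥ fun _ => (1 : ℂ)) := by fun_prop
    exact h2.continuousAt.comp h1
  have hlim := hc.tendsto.comp h0
  have hval : 1 + T.bC ⬝ᵥ (((0 : ℂ) • (1 : Matrix (Fin s) (Fin s) ℂ) - T.aC)⁻¹ *ᵥ fun _ => 1)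
      = T.stabInfty := by
    have hneg : (-T.aC)⁻¹ = -T.aC⁻¹ := by
      apply Matrix.inv_eq_left_inv
      rw [neg_mul_neg]
      exact Matrix.nonsing_inv_mul _ (isUnit_iff_ne_zero.2 hdet)
    rw [zero_smul, zero_sub, hneg, Matrix.neg_mulVec, dotProduct_neg]
    rfl
  rw [hval] at hlim
  refine hlim.congr' ?_
  have hz : ∀ᶠ z : ℂ in Filter.cocompact ℂ, z ≠ 0 := by
    have := (isCompact_singleton (x := (0 : ℂ))).compl_mem_cocompact
    filter_upwards [this] with z hz
    simpa using hz
  filter_upwards [hz] with z hz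
  have hm : (1 - z • T.aC) = z • (z⁻¹ • (1 : Matrix (Fin s) (Fin s) ℂ) - T.aC) := by
    rw [smul_sub, smul_smul, mul_inv_cancel₀ hz, one_smul]
  have hi : (z⁻¹ • (1 : Matrix (Fin s) (Fin s) ℂ) - T.aC)⁻¹ = z • (1 - z • T.aC)⁻¹ := by
    rw [hm]
    by_cases hu : IsUnit (z⁻¹ • (1 : Matrix (Fin s) (Fin s) ℂ) - T.aC).det
    · have := Matrix.inv_smul' (z⁻¹ • (1 : Matrix (Fin s) (Fin s) ℂ) - T.aC) (Units.mk0 z hz) hu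
      simp only [Units.smul_def, Units.val_mk0, Units.val_inv_eq_inv_val] at this
      rw [this, smul_smul, mul_inv_cancel₀ hz, one_smul]
    · have hu' : ¬ IsUnit (z • (z⁻¹ • (1 : Matrix (Fin s) (Fin s) ℂ) - T.aC)).det := by
        rw [Matrix.det_smul]
        simpa [hz] using hu
      rw [Matrix.nonsing_inv_apply_not_isUnit _ hu, Matrix.nonsing_inv_apply_not_isUnit _ hu',
        smul_zero]
  simp only [Function.comp, stab, hi, Matrix.smul_mulVec, dotProduct_smul, smul_eq_mul]

end ButcherTableau

section Operators

variable {X : Type*} [NormedAddCommGroup X] [NormedSpace ℂ X]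

/-- The sector `Σ_ϑ = {z ≠ 0 : |arg z| < ϑ}`. -/
def sector (θ : ℝ) : Set ℂ :=
  {z | z ≠ 0 ∧ |z.arg| < θ}

/-- The bounded operator `S` is the resolvent `(μ - A)⁻¹` of the (unbounded) operator `A`. -/
def IsResolventAt (A : X →ₗ.[ℂ] X) (μ : ℂ) (S : X →L[ℂ] X) : Prop :=
  (∀ x : A.domain, S (μ • (x : X) - A x) = x) ∧
    ∀ y : X, ∃ h : S y ∈ A.domain, μ • S y - A ⟨S y, h⟩ = y

/-- The sector `Σ_ϑ` lies in the resolvent set of `A`, and the operators `A (μ - A)⁻¹` are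
bounded on `X`, uniformly for `μ ∈ Σ_ϑ`. -/
def IsUniformlyBoundedOnSector (A : X →ₗ.[ℂ] X) (θ : ℝ) : Prop :=
  ∃ M : ℝ, ∀ μ ∈ sector θ, ∃ S : X →L[ℂ] X, IsResolventAt A μ S ∧
    ∀ (y : X) (h : S y ∈ A.domain), ‖A ⟨S y, h⟩‖ ≤ M * ‖y‖

variable {s : ℕ}

/-- The values `F_n = (f(t_n + c_i τ))_i` of the inhomogeneity in the `n`-th step, `t_n = n τ`. -/
def rkData (T : ButcherTableau s) (τ : ℝ) (f : ℝ → X) (n : ℕ) : Fin s → X :=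
  fun i => f (n * τ + T.c i * τ)

/-- `(u, U)` is the numerical solution, with internal stages `U n i` in the domain of `A`, that the
Runge--Kutta method with stepsize `τ` produces for `u' = A u + f`, `u(0) = 0`. The increments
`A U_{ni} + f(t_n + c_i τ)` are denoted `dU n i`. -/
def IsRKSolution (A : X →ₗ.[ℂ] X) (T : ButcherTableau s) (τ : ℝ) (f : ℝ → X)
    (u : ℕ → X) (U : ℕ → Fin s → A.domain) : Prop :=
  let dU : ℕ → Fin s → X := fun n i => A (U n i) + rkData T τ f n i
  u 0 = 0 ∧
    (∀ n i, (U n i : X) = u n + (τ : ℂ) • ∑ j, (T.a i j : ℂ) • dU n j) ∧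
    ∀ n, u (n + 1) = u n + (τ : ℂ) • ∑ i, (T.b i : ℂ) • dU n i

end Operators

/-- The `ℓ^p` norm, `1 ≤ p ≤ ∞`, of the finite sequence `(v_n)_{n=0}^{N-1}`. -/
def seqNorm {E : Type*} [NormedAddCommGroup E] (p : ℝ≥0∞) (N : ℕ) (v : ℕ → E) : ℝ :=
  ‖(WithLp.toLp p fun n : Fin N => v n : PiLp p fun _ : Fin N => E)‖

end

/-! Put `S = (1 - τA)⁻¹` and `w = 1/(1 - z)`. The stability function is a quotient of polynomials
`num`/`den` in `w`, with z = ∞ at w = 0 and z = 0 at w = 1, so R(τA) is a quotient of polynomials in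
the bounded operator `S`, and no contour integral over unbounded operators is needed. Cramer's rule
over ℂ[X] solves the stage equations and gives a discrete variation-of-constants formula: Au_{n+1}
is the convolution of the data with the kernels R(τA)^k den(S)⁻¹ (S - 1) p_i(S), p_i = `weightPoly`.
If these are O(1/(k+1)) uniformly in τ, Young's inequality and the harmonic sum give the factor log
N.

The decay is Ritt's: ‖R^k (R - 1)‖ = O(1/k) once ‖(1 - ωR)⁻¹‖ = O(1/|1 - ω|) for |ω| < 1. Here 1 -
ωR(τA) = den(S)⁻¹ (den - ω num)(S). A root w ≠ 0 of den - ω num belongs to a z with Re z > 0, by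
A-stability, and |R(∞)| < 1 keeps the roots away from w = 0. Hence every linear factor has an
inverse controlled by the sectorial bound, while the value of the polynomial at w = 1 is exactly 1 -
ω.

To pass from R - 1 to the actual kernel, write den⁻¹ (X - 1) p_i = (R - 1) p_i / q with q = Σ p_i
(`weightSum`). The operator q(S) is invertible: zeros of q with Re z < 0 are excluded by the maximum
principle, z = 0 by the order condition, and z = ∞ by R(∞) ≠ 1.

Uniformity in τ costs nothing: the argument runs in an arbitrary Banach algebra and is applied to
bounded functions of τ. The stages need only the boundedness of den(S)⁻¹ p(S) for finitely many p.
-/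

noncomputable section

/-! ### Ritt's condition and decay of `T ^ n * (T - 1)` -/

section PowerBound

open Metric Real

/-- Cauchy's estimate for the coefficients of a power series, with the mean of `‖f‖` on a circle. -/
theorem norm_coeff_le_of_hasSum_of_differentiableOn {E : Type*} [NormedAddCommGroup E]
    [NormedSpace ℂ E] [CompleteSpace E] {f : ℂ → E} {a : ℕ → E} {ρ : ℝ} (hρ : 0 < ρ)
    (hf : DifferentiableOn ℂ f (closedBall 0 ρ))
    (ha : ∀ᶠ z in 𝓝 (0 : ℂ), HasSum (fun n => z ^ n • a n) (f z)) (n : ℕ) :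
    ‖a n‖ ≤ ((2 * π)⁻¹ * ∫ t in (0 : ℝ)..2 * π, ‖f (circleMap 0 ρ t)‖) * ρ⁻¹ ^ n := by
  let p : FormalMultilinearSeries ℂ ℂ E := fun n =>
    ContinuousMultilinearMap.mkPiRing ℂ (Fin n) (a n)
  have hp : HasFPowerSeriesAt f p 0 := by
    rw [hasFPowerSeriesAt_iff]
    simpa [p, FormalMultilinearSeries.coeff] using ha
  lift ρ to NNReal using hρ.le
  have hq := (hf.hasFPowerSeriesOnBall (by exact_mod_cast hρ)).hasFPowerSeriesAt
  have h := norm_cauchyPowerSeries_le f 0 ρ n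
  rw [← hp.eq_formalMultilinearSeries hq] at h
  simpa [p, ContinuousMultilinearMap.norm_mkPiRing] using h

/-- Both squares equal 1 - 2ρ cos t + ρ². This turns |1 - ω|⁻² on the circle of radius ρ into a
Poisson kernel on the unit circle. -/
theorem norm_circleMap_zero_sub_one (ρ t : ℝ) :
    ‖1 - circleMap 0 ρ t‖ = ‖circleMap 0 1 t - (ρ : ℂ)‖ := by
  rw [← sq_eq_sq₀ (norm_nonneg _) (norm_nonneg _), ← Complex.normSq_eq_norm_sq,
    ← Complex.normSq_eq_norm_sq]
  simp only [circleMap, zero_add, Complex.normSq_apply, Complex.sub_re, Complex.sub_im,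
    Complex.mul_re, Complex.mul_im, Complex.ofReal_re, Complex.ofReal_im, Complex.exp_ofReal_mul_I_re,
    Complex.exp_ofReal_mul_I_im, Complex.one_re, Complex.one_im]
  linear_combination (ρ ^ 2 - 1) * Real.sin_sq_add_cos_sq t

/-- The integral of the Poisson kernel. -/
theorem integral_inv_norm_one_sub_circleMap_sq {ρ : ℝ} (h0 : 0 < ρ) (h1 : ρ < 1) :
    (2 * π)⁻¹ * ∫ t in (0 : ℝ)..2 * π, (‖1 - circleMap 0 ρ t‖ ^ 2)⁻¹ = (1 - ρ ^ 2)⁻¹ := by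
  have h := DiffContOnCl.circleAverage_poissonKernel_smul' (f := fun _ => (1 : ℂ)) (c := 0)
    (R := 1) (w := ρ) diffContOnCl_const (by simpa [abs_of_pos h0] using h1)
  have h' : Real.circleAverage (fun z : ℂ => (1 - ρ ^ 2) / ‖z - ρ‖ ^ 2) 0 1 = 1 := by
    rw [Real.circleAverage_def] at h ⊢
    simp only [sub_zero, Complex.real_smul, mul_one, norm_circleMap_zero, abs_one, one_pow,
      Complex.norm_real, Real.norm_eq_abs, sq_abs, intervalIntegral.integral_ofReal] at h
    simpa only [smul_eq_mul] using mod_cast h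
  rw [Real.circleAverage_def] at h'
  simp only [← norm_circleMap_zero_sub_one, smul_eq_mul, div_eq_mul_inv,
    intervalIntegral.integral_const_mul] at h'
  have : 1 - ρ ^ 2 ≠ 0 := by nlinarith
  field_simp at h' ⊢
  linarith

variable {𝔸 : Type*} [NormedRing 𝔸] [NormedAlgebra ℂ 𝔸] [CompleteSpace 𝔸]

/-- An element whose resolvent is `O(1 / |ω - 1|)` outside the closed unit disc satisfies
`‖T ^ n * (T - 1)‖ = O(1 / n)` (Ritt's condition). -/
theorem exists_norm_pow_mul_sub_one_le_div {T : 𝔸} {C : ℝ}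
    (hT : ∀ ω : ℂ, ‖ω‖ < 1 → ∃ V : 𝔸, V * (1 - ω • T) = 1 ∧ (1 - ω • T) * V = 1 ∧
      ‖V‖ * ‖1 - ω‖ ≤ C) :
    ∃ C' : ℝ, ∀ n : ℕ, ‖T ^ n * (T - 1)‖ ≤ C' / (n + 1) := by
  have h1 : 0 ≤ C := by
    obtain ⟨V, -, -, hV⟩ := hT 0 (by simp)
    exact (by positivity : 0 ≤ ‖V‖ * ‖1 - (0 : ℂ)‖).trans hV
  set C₁ : ℝ := ‖(1 : 𝔸)‖ * 2 + C
  have hu : ∀ ω : ℂ, ‖ω‖ < 1 → IsUnit (1 - ω • T) := fun ω hω => by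
    obtain ⟨V, hV, hV', -⟩ := hT ω hω
    exact ⟨⟨_, V, hV', hV⟩, rfl⟩
  -- The cube is chosen so that no logarithm is lost: the coefficients carry a factor of order n²,
  -- while `f` is O(|1 - ω|⁻²) because (T - 1)(1 - ωT)⁻¹ is bounded. The circle mean of |1 - ω|⁻² is
  -- (1 - ρ²)⁻¹ = O(n), and n/n² = 1/n.
  set f : ℂ → 𝔸 := fun ω => (T - 1) * (Ring.inverse (1 - ω • T)) ^ 3 with hf
  have hbound : ∀ ω : ℂ, ‖ω‖ < 1 → 1 / 2 ≤ ‖ω‖ →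
      ‖f ω‖ ≤ 2 * C₁ * C ^ 2 * (‖1 - ω‖ ^ 2)⁻¹ := by
    intro ω hω hω2
    obtain ⟨V, hV, hV', hVC⟩ := hT ω hω
    have hinv : (Ring.inverse (1 - ω • T)) = V :=
      left_inv_eq_right_inv (Ring.inverse_mul_cancel _ (hu ω hω)) hV'
    have hpos : 0 < ‖1 - ω‖ := by
      rw [norm_pos_iff, sub_ne_zero]; rintro rfl; simp at hω
    have hid : ω • ((T - 1) * V) = (1 - ω) • V - 1 := by
      have : ω • (T - 1) = (1 - ω) • (1 : 𝔸) - (1 - ω • T) := by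
        rw [smul_sub, sub_smul, one_smul]; abel
      rw [← smul_mul_assoc, this, sub_mul, hV', smul_mul_assoc, one_mul]
    have h3 : ‖(T - 1) * V‖ ≤ 2 * C₁ := by
      have h4 : ‖ω‖ * ‖(T - 1) * V‖ ≤ C + ‖(1 : 𝔸)‖ := by
        rw [← norm_smul, hid]
        refine (norm_sub_le _ _).trans (add_le_add_left ?_ _)
        rw [norm_smul, mul_comm]; exact hVC
      have := norm_nonneg ((T - 1) * V)
      have := norm_nonneg (1 : 𝔸)
      simp only [C₁]
      nlinarith
    have hV2 : ‖V‖ ≤ C * ‖1 - ω‖⁻¹ := by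
      rw [← div_eq_mul_inv, le_div_iff₀ hpos]; exact hVC
    calc ‖f ω‖ = ‖((T - 1) * V) * V * V‖ := by simp only [hf, hinv]; congr 1; noncomm_ring
      _ ≤ ‖(T - 1) * V‖ * ‖V‖ * ‖V‖ := by
        refine (norm_mul_le _ _).trans ?_
        gcongr
        exact norm_mul_le _ _
      _ ≤ 2 * C₁ * (C * ‖1 - ω‖⁻¹) * (C * ‖1 - ω‖⁻¹) := by
        have : 0 ≤ 2 * C₁ := (norm_nonneg _).trans h3
        gcongr
      _ = _ := by rw [← inv_pow]; ring
  have hdiff : ∀ ω : ℂ, ‖ω‖ < 1 → DifferentiableAt ℂ f ω := by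
    intro ω hω
    have H₁ : DifferentiableAt ℂ (fun w : ℂ => 1 - w • T) ω := by fun_prop
    have H₂ : DifferentiableAt ℂ (fun w : ℂ => (Ring.inverse (1 - w • T))) ω :=
      DifferentiableAt.comp (g := Ring.inverse) ω (differentiableAt_inverse (hu ω hω)) H₁
    exact (differentiableAt_const _).mul (H₂.pow 3)
  have hsum : ∀ᶠ z in 𝓝 (0 : ℂ),
      HasSum (fun n => z ^ n • (((n + 2).choose 2 : ℂ) • (T ^ n * (T - 1)))) (f z) := by
    have : ∀ᶠ z in 𝓝 (0 : ℂ), ‖z • T‖ < 1 := by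
      have hc : Continuous fun z : ℂ => ‖z • T‖ := by fun_prop
      exact hc.continuousAt.eventually_lt continuousAt_const (by simp)
    filter_upwards [this] with z hz
    have := (hasSum_choose_mul_geometric_of_norm_lt_one' 2 hz).mul_left (T - 1)
    have hterm : ∀ n : ℕ, (T - 1) * (((n + 2).choose 2 : 𝔸) * (z • T) ^ n) =
        z ^ n • (((n + 2).choose 2 : ℂ) • (T ^ n * (T - 1))) := by
      intro n
      have hc : (T - 1) * T ^ n = T ^ n * (T - 1) := ((Commute.refl T).sub_left (Commute.one_left T)).pow_right n
      rw [smul_pow, mul_smul_comm, mul_smul_comm, ← nsmul_eq_mul, ← Nat.cast_smul_eq_nsmul ℂ,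
        mul_smul_comm, hc]
    simpa only [hterm] using this
  refine ⟨2 * (2 * C₁ * C ^ 2) * exp 1, fun n => ?_⟩
  -- Here 1 - ρ = 1/(n + 2) balances ρ⁻ⁿ ≤ e against (1 - ρ²)⁻¹ ≤ n + 2, and ρ ≥ 1/2 already for n =
  -- 0.
  set ρ : ℝ := (n + 1) / (n + 2) with hρ
  have hn : (0 : ℝ) ≤ n := n.cast_nonneg
  have hρ0 : 0 < ρ := by positivity
  have hρ1 : ρ < 1 := by rw [hρ, div_lt_one (by positivity)]; linarith
  have hρ2 : 1 / 2 ≤ ρ := by rw [hρ, le_div_iff₀ (by positivity)]; linarith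
  have hcm : ∀ t, ‖circleMap 0 ρ t‖ = ρ := fun t => by simp [abs_of_pos hρ0]
  have hcoef := norm_coeff_le_of_hasSum_of_differentiableOn hρ0 (fun z hz =>
    (hdiff z ((mem_closedBall_zero_iff.1 hz).trans_lt hρ1)).differentiableWithinAt) hsum n
  have hcont1 : Continuous fun t => ‖f (circleMap 0 ρ t)‖ := by
    refine Continuous.norm (continuous_iff_continuousAt.2 fun t => ?_)
    exact ContinuousAt.comp (g := f) (hdiff _ (by rw [hcm]; exact hρ1)).continuousAt
      (continuous_circleMap 0 ρ).continuousAt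
  have hcont2 : Continuous fun t => 2 * C₁ * C ^ 2 * (‖1 - circleMap 0 ρ t‖ ^ 2)⁻¹ := by
    refine continuous_const.mul (Continuous.inv₀ (by fun_prop) fun t h => ?_)
    have h' : circleMap 0 ρ t = 1 := by
      rw [sq_eq_zero_iff, norm_eq_zero, sub_eq_zero] at h
      exact h.symm
    have := hcm t
    rw [h', norm_one] at this
    exact hρ1.ne' this
  have hint : (2 * π)⁻¹ * ∫ t in (0 : ℝ)..2 * π, ‖f (circleMap 0 ρ t)‖ ≤
      2 * C₁ * C ^ 2 * (1 - ρ ^ 2)⁻¹ := by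
    rw [← integral_inv_norm_one_sub_circleMap_sq hρ0 hρ1, mul_left_comm,
      ← intervalIntegral.integral_const_mul (2 * C₁ * C ^ 2)]
    refine mul_le_mul_of_nonneg_left ?_ (by positivity : (0 : ℝ) ≤ (2 * π)⁻¹)
    refine intervalIntegral.integral_mono_on two_pi_pos.le (hcont1.intervalIntegrable _ _)
      (hcont2.intervalIntegrable _ _) fun t _ => ?_
    exact hbound _ (by rw [hcm]; exact hρ1) (by rw [hcm]; exact hρ2)
  have hpow : ρ⁻¹ ^ n ≤ exp 1 := by
    have h1 : ρ⁻¹ ≤ exp (1 / (n + 1)) := by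
      refine le_trans (le_of_eq ?_) (add_one_le_exp _)
      rw [hρ]; field_simp; ring
    calc ρ⁻¹ ^ n ≤ exp (1 / (n + 1)) ^ n := by gcongr
      _ = exp (n * (1 / (n + 1))) := by rw [exp_nat_mul]
      _ ≤ exp 1 := by
        gcongr
        rw [mul_one_div, div_le_one (by positivity)]; linarith
  have hC1 : 0 ≤ C₁ := by positivity
  have hρn : (1 - ρ ^ 2)⁻¹ ≤ (n : ℝ) + 2 := by
    have : 1 - ρ ≤ 1 - ρ ^ 2 := by nlinarith
    calc (1 - ρ ^ 2)⁻¹ ≤ (1 - ρ)⁻¹ := inv_anti₀ (by linarith) this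
      _ = n + 2 := by rw [hρ]; field_simp; ring
  have hchoose : ((n + 2).choose 2 : ℝ) = (n + 2) * (n + 1) / 2 := by
    rw [Nat.cast_choose_two]; push_cast; ring
  rw [norm_smul, Complex.norm_natCast, hchoose] at hcoef
  have hfin : (n + 2) * (n + 1) / 2 * ‖T ^ n * (T - 1)‖ ≤
      2 * C₁ * C ^ 2 * (n + 2) * exp 1 := by
    refine hcoef.trans ?_
    refine mul_le_mul (hint.trans ?_) hpow (by positivity) (by positivity)
    exact mul_le_mul_of_nonneg_left hρn (by positivity)
  rw [le_div_iff₀ (by positivity)]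
  have h2 : (0 : ℝ) < n + 2 := by positivity
  nlinarith

end PowerBound

/-! ### Inverses of polynomials of a sectorial resolvent -/

section ResolventCalculus

open Polynomial

variable {𝔸 : Type*} [NormedRing 𝔸] [NormedAlgebra ℂ 𝔸]

/-- With `S = (1 - B)⁻¹`, the element `1 + (μ - 1) S = (μ - B) S` is invertible for all `μ` in the
sector, and its inverse `1 + (1 - μ) (μ - B)⁻¹` is bounded by `K (1 + 1 / |μ|)`. -/
def HasSectorialResolvent (θ K : ℝ) (S : 𝔸) : Prop :=
  ∀ μ ∈ sector θ, ∃ V : 𝔸, V * (1 + (μ - 1) • S) = 1 ∧ (1 + (μ - 1) • S) * V = 1 ∧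
    ‖V‖ * ‖μ‖ ≤ K * (1 + ‖μ‖)

/-- With μ = 1 - 1/r, the factor at `S` is 1 + (μ - 1)S and its value at 1 is μ. The sectorial bound
controls (norm of inverse)·|μ| by K(1 + |μ|), where |μ| ≤ 1 + 1/δ, and these products multiply up.
-/
theorem HasSectorialResolvent.exists_inverse_aeval_prod {θ K δ : ℝ} {S : 𝔸}
    (hS : HasSectorialResolvent θ K S) (hK : 0 ≤ K) (hδ : 0 < δ) (m : Multiset ℂ)
    (hm : ∀ r ∈ m, δ ≤ ‖r‖ ∧ 1 - r⁻¹ ∈ sector θ) :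
    ∃ V : 𝔸, V * aeval S (m.map fun r => 1 - C r⁻¹ * X).prod = 1 ∧
      aeval S (m.map fun r => 1 - C r⁻¹ * X).prod * V = 1 ∧
      ‖V‖ * ‖((m.map fun r => 1 - C r⁻¹ * X).prod).eval 1‖ ≤
        ‖(1 : 𝔸)‖ * (K * (2 + δ⁻¹)) ^ Multiset.card m := by
  induction m using Multiset.induction_on with
  | empty => exact ⟨1, by simp⟩
  | cons r m ih =>
    obtain ⟨V, hV, hV', hb⟩ := ih fun q hq => hm q (Multiset.mem_cons_of_mem hq)
    obtain ⟨hr, hrs⟩ := hm r (Multiset.mem_cons_self r m)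
    obtain ⟨v, hv, hv', hvb⟩ := hS _ hrs
    have hfac : aeval S (1 - C r⁻¹ * X : ℂ[X]) = 1 + (1 - r⁻¹ - 1) • S := by
      simp [Algebra.smul_def]
      rw [sub_eq_add_neg]
    refine ⟨V * v, ?_, ?_, ?_⟩
    · rw [Multiset.map_cons, Multiset.prod_cons, map_mul, hfac, mul_assoc, ← mul_assoc v, hv,
        one_mul, hV]
    · rw [Multiset.map_cons, Multiset.prod_cons, map_mul, hfac, mul_assoc, ← mul_assoc _ V, hV',
        one_mul, hv']
    · rw [Multiset.map_cons, Multiset.prod_cons, eval_mul, Multiset.card_cons, pow_succ]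
      have he : (1 - C r⁻¹ * X : ℂ[X]).eval 1 = 1 - r⁻¹ := by simp
      have hri : ‖r⁻¹‖ ≤ δ⁻¹ := by rw [norm_inv]; exact inv_anti₀ hδ hr
      have h1 : ‖1 - r⁻¹‖ ≤ 1 + δ⁻¹ := (norm_sub_le _ _).trans (by rw [norm_one]; gcongr)
      rw [he, norm_mul (1 - r⁻¹)]
      calc ‖V * v‖ * (‖1 - r⁻¹‖ * ‖((m.map fun r => 1 - C r⁻¹ * X).prod).eval 1‖)
          ≤ (‖V‖ * ‖v‖) * (‖1 - r⁻¹‖ * ‖((m.map fun r => 1 - C r⁻¹ * X).prod).eval 1‖) := by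
            gcongr; exact norm_mul_le _ _
        _ = (‖V‖ * ‖((m.map fun r => 1 - C r⁻¹ * X).prod).eval 1‖) * (‖v‖ * ‖1 - r⁻¹‖) := by ring
        _ ≤ (‖(1 : 𝔸)‖ * (K * (2 + δ⁻¹)) ^ Multiset.card m) * (K * (1 + ‖1 - r⁻¹‖)) := by gcongr
        _ ≤ (‖(1 : 𝔸)‖ * (K * (2 + δ⁻¹)) ^ Multiset.card m) * (K * (2 + δ⁻¹)) := by
            gcongr ?_ * (K * ?_)
            linarith
        _ = _ := by ring

/-- A polynomial whose roots `r ≠ 0` correspond to points `1 - 1 / r` of the sector is invertible at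
`S`. -/
theorem HasSectorialResolvent.exists_inverse_aeval {θ K δ : ℝ} {S : 𝔸} {d : ℕ}
    (hS : HasSectorialResolvent θ K S) (hK : 1 ≤ K) (hδ : 0 < δ) {p : ℂ[X]} (hp : p ≠ 0)
    (hd : p.natDegree ≤ d) (hr : ∀ r, p.eval r = 0 → δ ≤ ‖r‖ ∧ 1 - r⁻¹ ∈ sector θ) :
    ∃ V : 𝔸, V * aeval S p = 1 ∧ aeval S p * V = 1 ∧
      ‖V‖ * ‖p.eval 1‖ ≤ ‖(1 : 𝔸)‖ * (K * (2 + δ⁻¹)) ^ d := by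
  have hroots : ∀ r ∈ p.roots, δ ≤ ‖r‖ ∧ 1 - r⁻¹ ∈ sector θ := fun r h =>
    hr r ((mem_roots hp).1 h)
  set q : ℂ[X] := (p.roots.map fun r => 1 - C r⁻¹ * X).prod with hq
  obtain ⟨V, hV, hV', hb⟩ :=
    hS.exists_inverse_aeval_prod (by linarith) hδ p.roots hroots
  rw [← hq] at hV hV' hb
  -- The scalar `c` drops out of the final estimate, since it scales the inverse by c⁻¹ and p(1) by
  -- c.
  obtain ⟨c, hc, hpq⟩ : ∃ c : ℂ, c ≠ 0 ∧ p = C c * q := by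
    refine ⟨p.leadingCoeff * (p.roots.map fun r => -r).prod,
      mul_ne_zero (leadingCoeff_ne_zero.2 hp) (Multiset.prod_ne_zero fun h => ?_), ?_⟩
    · obtain ⟨r, hr', hr0⟩ := Multiset.mem_map.1 h
      have := (hroots r hr').1
      rw [neg_eq_zero.1 hr0, norm_zero] at this
      linarith
    · conv_lhs => rw [(IsAlgClosed.splits p).eq_prod_roots]
      rw [C_mul, mul_assoc, map_multiset_prod, hq, Multiset.map_map, ← Multiset.prod_map_mul]
      congr 2
      refine Multiset.map_congr rfl fun r h => ?_
      have hr0 : r ≠ 0 := by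
        rintro rfl
        have := (hroots 0 h).1
        rw [norm_zero] at this
        linarith
      have : C r * C r⁻¹ = (1 : ℂ[X]) := by rw [← C_mul, mul_inv_cancel₀ hr0, C_1]
      simp only [Function.comp, C_neg]
      linear_combination (-X : ℂ[X]) * this
  have haev : aeval S p = c • aeval S q := by rw [hpq, map_mul, aeval_C, Algebra.smul_def]
  refine ⟨c⁻¹ • V, ?_, ?_, ?_⟩
  · rw [haev, smul_mul_smul_comm, inv_mul_cancel₀ hc, hV, one_smul]
  · rw [haev, smul_mul_smul_comm, mul_inv_cancel₀ hc, hV', one_smul]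
  · have h1 : ‖c⁻¹ • V‖ * ‖p.eval 1‖ = ‖V‖ * ‖q.eval 1‖ := by
      rw [hpq, eval_mul, eval_C, norm_smul, norm_mul, norm_inv]
      field_simp [norm_ne_zero_iff.2 hc]
    rw [h1]
    refine hb.trans (mul_le_mul_of_nonneg_left ?_ (norm_nonneg _))
    -- The number of roots can vary within a family of polynomials; the exponent `d` makes the bound
    -- uniform.
    refine pow_le_pow_right₀ ?_ ((card_roots' p).trans hd)
    have := inv_pos.2 hδ
    nlinarith

/-- The resolvent of a rational function `P / Q` of `S` near the closed unit disc, where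
`P / Q = 1` at `1` and `|P / Q| < 1` at `0`. -/
theorem HasSectorialResolvent.exists_inverse_one_sub_smul {θ K : ℝ} {S : 𝔸}
    (hS : HasSectorialResolvent θ K S) (hK : 1 ≤ K) {P Q : ℂ[X]}
    (h0 : ‖P.eval 0‖ < ‖Q.eval 0‖) (hP : P.eval 1 = 1) (hQ : Q.eval 1 = 1)
    (hroot : ∀ ω : ℂ, ‖ω‖ < 1 → ∀ r : ℂ, r ≠ 0 → Q.eval r = ω * P.eval r → 1 - r⁻¹ ∈ sector θ) :
    ∃ Qi : 𝔸, Qi * aeval S Q = 1 ∧ aeval S Q * Qi = 1 ∧ ∃ c : ℝ, ∀ ω : ℂ, ‖ω‖ < 1 →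
      ∃ V : 𝔸, V * (1 - ω • (Qi * aeval S P)) = 1 ∧ (1 - ω • (Qi * aeval S P)) * V = 1 ∧
        ‖V‖ * ‖1 - ω‖ ≤ c := by
  -- On this disc |P| < |Q|, so Q = ωP has no root there for any |ω| < 1; thus δ does not depend on
  -- ω.
  obtain ⟨δ, hδ, hδr⟩ : ∃ δ > 0, ∀ w : ℂ, ‖w‖ < δ →
      ‖Q.eval w - Q.eval 0‖ + ‖P.eval w - P.eval 0‖ < ‖Q.eval 0‖ - ‖P.eval 0‖ := by
    have hc : Continuous fun w : ℂ => ‖Q.eval w - Q.eval 0‖ + ‖P.eval w - P.eval 0‖ := by fun_prop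
    have := hc.continuousAt.eventually_lt
      (continuousAt_const (x := (0 : ℂ)) (y := ‖Q.eval 0‖ - ‖P.eval 0‖)) (by simpa using h0)
    simpa using Metric.eventually_nhds_iff.1 this
  have hN : ∀ ω : ℂ, ‖ω‖ < 1 → ∃ V : 𝔸, V * aeval S (Q - C ω * P) = 1 ∧
      aeval S (Q - C ω * P) * V = 1 ∧
      ‖V‖ * ‖1 - ω‖ ≤ ‖(1 : 𝔸)‖ * (K * (2 + δ⁻¹)) ^ (max Q.natDegree P.natDegree) := by
    intro ω hω
    have hbig : ∀ r, (Q - C ω * P).eval r = 0 → δ ≤ ‖r‖ := by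
      intro r hr
      by_contra! hlt
      have h1 := hδr r hlt
      rw [eval_sub, eval_mul, eval_C, sub_eq_zero] at hr
      have h2 : ‖Q.eval 0‖ ≤ ‖Q.eval r‖ + ‖Q.eval r - Q.eval 0‖ := by
        rw [norm_sub_rev]; exact norm_le_insert' _ _
      have h3 : ‖P.eval r‖ ≤ ‖P.eval 0‖ + ‖P.eval r - P.eval 0‖ := norm_le_insert' _ _
      have h4 : ‖Q.eval r‖ ≤ ‖P.eval r‖ := by
        rw [hr, norm_mul]; exact mul_le_of_le_one_left (norm_nonneg _) hω.le
      linarith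
    have hne : Q - C ω * P ≠ 0 := by
      intro h
      have := hbig 0 (by rw [h, eval_zero])
      rw [norm_zero] at this
      linarith
    have hdeg : (Q - C ω * P).natDegree ≤ max Q.natDegree P.natDegree :=
      (natDegree_sub_le _ _).trans (max_le_max le_rfl (natDegree_C_mul_le _ _))
    have := hS.exists_inverse_aeval hK hδ hne hdeg fun r hr => ⟨hbig r hr, by
      refine hroot ω hω r ?_ ?_
      · rintro rfl
        have := hbig 0 hr
        rw [norm_zero] at this
        linarith
      · simpa [sub_eq_zero] using hr⟩
    simpa [hP, hQ] using this
  obtain ⟨Qi, hQi, hQi', -⟩ := hN 0 (by simp)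
  simp only [C_0, zero_mul, sub_zero] at hQi hQi'
  refine ⟨Qi, hQi, hQi',
    ‖aeval S Q‖ * (‖(1 : 𝔸)‖ * (K * (2 + δ⁻¹)) ^ (max Q.natDegree P.natDegree)), fun ω hω => ?_⟩
  obtain ⟨V, hV, hV', hb⟩ := hN ω hω
  have hfac : 1 - ω • (Qi * aeval S P) = Qi * aeval S (Q - C ω * P) := by
    rw [map_sub, map_mul, aeval_C, mul_sub, hQi, ← Algebra.smul_def, mul_smul_comm]
  refine ⟨V * aeval S Q, ?_, ?_, ?_⟩
  · rw [hfac, mul_assoc, ← mul_assoc _ Qi, hQi', one_mul, hV]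
  · rw [hfac, mul_assoc, ← mul_assoc _ V, hV', one_mul, hQi]
  · calc ‖V * aeval S Q‖ * ‖1 - ω‖ ≤ ‖V‖ * ‖aeval S Q‖ * ‖1 - ω‖ := by
          gcongr; exact norm_mul_le _ _
      _ = ‖aeval S Q‖ * (‖V‖ * ‖1 - ω‖) := by ring
      _ ≤ _ := by gcongr

end ResolventCalculus

/-! ### The stability function in the variable w = 1/(1 - z) -/

namespace ButcherTableau

open Polynomial

variable {s : ℕ} (T : ButcherTableau s)

/-- The matrix `a + w (1 - a) = w (1 - z a)`, `z = 1 - 1 / w`, with entries polynomials in `w`. -/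
def stageMatrix : Matrix (Fin s) (Fin s) ℂ[X] :=
  T.aC.map C + (X : ℂ[X]) • (1 - T.aC.map C)

/-- The denominator of the stability function, as a polynomial in `w = 1 / (1 - z)`. -/
def den : ℂ[X] :=
  T.stageMatrix.det

/-- The row vector `bᵀ adj (a + w (1 - a))`. -/
def weightPoly (i : Fin s) : ℂ[X] :=
  ∑ k, C (T.bC k) * T.stageMatrix.adjugate k i

/-- The sum of the entries of `weightPoly`. -/
def weightSum : ℂ[X] :=
  ∑ i, T.weightPoly i

/-- The numerator of the stability function, as a polynomial in `w = 1 / (1 - z)`. -/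
def num : ℂ[X] :=
  T.den + (X - 1) * T.weightSum

theorem map_eval_stageMatrix (w : ℂ) :
    (evalRingHom w).mapMatrix T.stageMatrix = T.aC + w • (1 - T.aC) := by
  ext i j
  by_cases h : i = j
  · simp [stageMatrix, h]
  · simpa [stageMatrix, h] using mul_comm _ _

theorem eval_den (w : ℂ) : T.den.eval w = (T.aC + w • (1 - T.aC)).det := by
  rw [← T.map_eval_stageMatrix, ← RingHom.map_det]
  rfl

theorem eval_weightSum (w : ℂ) :
    T.weightSum.eval w = T.bC ⬝ᵥ ((T.aC + w • (1 - T.aC)).adjugate *ᵥ fun _ => 1) := by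
  rw [← T.map_eval_stageMatrix, ← RingHom.map_adjugate]
  simp only [weightSum, weightPoly, eval_finsetSum, dotProduct, Matrix.mulVec, eval_mul, eval_C,
    mul_one, Finset.mul_sum]
  rw [Finset.sum_comm]
  rfl

theorem eval_weightSum_eq {w : ℂ} (h : T.den.eval w ≠ 0) :
    T.weightSum.eval w =
      T.den.eval w * (T.bC ⬝ᵥ ((T.aC + w • (1 - T.aC))⁻¹ *ᵥ fun _ => 1)) := by
  rw [eval_weightSum, eval_den] at *
  rw [Matrix.inv_def, Ring.inverse_eq_inv', Matrix.smul_mulVec, dotProduct_smul, smul_eq_mul,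
    ← mul_assoc, mul_inv_cancel₀ h, one_mul]

theorem stageMatrix_eval_eq_smul {w : ℂ} (hw : w ≠ 0) :
    T.aC + w • (1 - T.aC) = w • (1 - (1 - w⁻¹) • T.aC) := by
  rw [smul_sub, smul_sub, smul_smul, mul_sub, mul_inv_cancel₀ hw, sub_smul, mul_one, one_smul]
  abel

theorem eval_den_ne_zero_iff {w : ℂ} (hw : w ≠ 0) :
    T.den.eval w ≠ 0 ↔ IsUnit (1 - (1 - w⁻¹) • T.aC).det := by
  rw [eval_den, T.stageMatrix_eval_eq_smul hw, Matrix.det_smul, isUnit_iff_ne_zero]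
  simp [hw]

/-- The stability function in terms of the variable `w = 1 / (1 - z)`. -/
theorem stab_eq {w : ℂ} (hw : w ≠ 0) (h : T.den.eval w ≠ 0) :
    T.stab (1 - w⁻¹) = 1 + (w - 1) * T.weightSum.eval w / T.den.eval w := by
  have hu := (T.eval_den_ne_zero_iff hw).1 h
  have hi : (w • (1 - (1 - w⁻¹) • T.aC))⁻¹ = w⁻¹ • (1 - (1 - w⁻¹) • T.aC)⁻¹ := by
    have := Matrix.inv_smul' (1 - (1 - w⁻¹) • T.aC) (Units.mk0 w hw) hu
    simpa only [Units.smul_def, Units.val_mk0, Units.val_inv_eq_inv_val] using this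
  rw [T.eval_weightSum_eq h, T.stageMatrix_eval_eq_smul hw, hi, Matrix.smul_mulVec, dotProduct_smul,
    smul_eq_mul, stab]
  field_simp

theorem num_eval_eq {w : ℂ} (hw : w ≠ 0) (h : T.den.eval w ≠ 0) :
    T.num.eval w = T.den.eval w * T.stab (1 - w⁻¹) := by
  rw [T.stab_eq hw h, num]
  simp only [eval_add, eval_mul, eval_sub, eval_X, eval_one]
  field_simp

theorem den_eval_one : T.den.eval 1 = 1 := by
  simp [eval_den]

theorem num_eval_one : T.num.eval 1 = 1 := by
  simp [num, den_eval_one]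

theorem weightSum_eval_one : T.weightSum.eval 1 = ∑ i, T.bC i := by
  simp [eval_weightSum, dotProduct]

theorem den_eval_zero_ne_zero (h : IsUnit T.a.det) : T.den.eval 0 ≠ 0 := by
  have : T.aC.det = ((T.a.det : ℝ) : ℂ) := (RingHom.map_det Complex.ofRealHom T.a).symm
  rw [eval_den, zero_smul, add_zero, this]
  exact_mod_cast h.ne_zero

theorem weightSum_eval_zero (h : IsUnit T.a.det) :
    T.weightSum.eval 0 = T.den.eval 0 * (1 - T.stabInfty) := by
  rw [T.eval_weightSum_eq (T.den_eval_zero_ne_zero h), stabInfty]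
  simp

theorem num_eval_zero (h : IsUnit T.a.det) : T.num.eval 0 = T.den.eval 0 * T.stabInfty := by
  simp only [num, eval_add, eval_mul, eval_sub, eval_X, eval_one, T.weightSum_eval_zero h]
  ring

theorem norm_num_eval_zero_lt (h : IsUnit T.a.det) (hinf : ‖T.stabInfty‖ < 1) :
    ‖T.num.eval 0‖ < ‖T.den.eval 0‖ := by
  rw [T.num_eval_zero h, norm_mul]
  exact mul_lt_of_lt_one_right (norm_pos_iff.2 (T.den_eval_zero_ne_zero h)) hinf

variable {T}

/-- Near 0 one has R(z) = 1 + zψ(z) with ψ(0) equal to this value, and the order condition says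
R'(0) = 1. -/
theorem HasOrderAtLeastOne.weightSum_eval_one (hord : T.HasOrderAtLeastOne) :
    T.weightSum.eval 1 = 1 := by
  have h1 : HasDerivAt T.stab 1 0 := by
    have hd : HasDerivAt (fun z => T.stab z - Complex.exp z) 0 0 := by
      have : (fun z : ℂ => T.stab z - Complex.exp z) =O[𝓝 0] fun z => ‖z - 0‖ ^ 2 := by
        refine hord.trans (Asymptotics.IsBigO.of_norm_right ?_)
        exact Asymptotics.isBigO_of_le _ fun z => by simp
      simpa using (this.hasFDerivAt (by norm_num)).hasDerivAt
    have h := hd.add (Complex.hasDerivAt_exp 0)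
    rw [Complex.exp_zero, zero_add] at h
    exact h.congr_of_eventuallyEq (Filter.Eventually.of_forall fun z => by simp)
  let ψ : ℂ → ℂ := fun z =>
    (1 - z)⁻¹ * (T.weightSum.eval (1 - z)⁻¹ / T.den.eval (1 - z)⁻¹)
  have hψ : DifferentiableAt ℂ ψ 0 := by
    have hi : DifferentiableAt ℂ (fun z : ℂ => (1 - z)⁻¹) 0 :=
      ((differentiableAt_const _).sub differentiableAt_id).inv (by simp)
    have hp : ∀ p : ℂ[X], DifferentiableAt ℂ (fun z : ℂ => p.eval (1 - z)⁻¹) 0 := fun p =>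
      p.differentiableAt.comp (0 : ℂ) hi
    exact hi.mul ((hp _).div (hp _) (by simp [den_eval_one]))
  have h2 : HasDerivAt (fun z => 1 + z * ψ z) (ψ 0) 0 := by
    simpa using ((hasDerivAt_id (0 : ℂ)).mul hψ.hasDerivAt).const_add 1
  have heq : T.stab =ᶠ[𝓝 0] fun z => 1 + z * ψ z := by
    have hc : ContinuousAt (fun z : ℂ => T.den.eval (1 - z)⁻¹) 0 :=
      T.den.continuous.continuousAt.comp
        (ContinuousAt.inv₀ (continuousAt_const.sub continuousAt_id) (by simp))
    have h3 := hc.eventually_ne (y := 0) (by simp [den_eval_one])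
    have h4 : ∀ᶠ z : ℂ in 𝓝 0, z ≠ 1 := eventually_ne_nhds zero_ne_one
    filter_upwards [h3, h4] with z hz hz1
    have hz2 : 1 - z ≠ 0 := sub_ne_zero.2 hz1.symm
    have := T.stab_eq (inv_ne_zero hz2) hz
    rw [inv_inv, sub_sub_cancel] at this
    rw [this]
    have h5 : (1 - z)⁻¹ - 1 = z * (1 - z)⁻¹ := by field_simp; ring
    simp only [ψ]
    rw [h5]
    ring
  have := (h2.congr_of_eventuallyEq heq).unique h1
  simpa [ψ, den_eval_one] using this

theorem IsAStable.den_eval_ne_zero (hstab : T.IsAStable) {w : ℂ} (hw : w ≠ 0)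
    (h : (1 - w⁻¹).re ≤ 0) : T.den.eval w ≠ 0 :=
  (T.eval_den_ne_zero_iff hw).2 (hstab _ h).1

/-- Otherwise the equation would read ωR(z) = 1 at a point with Re z ≤ 0, against |ω| < 1 and |R(z)|
≤ 1. -/
theorem IsAStable.re_pos_of_den_eval_eq (hstab : T.IsAStable) {ω w : ℂ} (hω : ‖ω‖ < 1)
    (hw : w ≠ 0) (h : T.den.eval w = ω * T.num.eval w) : 0 < (1 - w⁻¹).re := by
  by_contra! hre
  have hne := hstab.den_eval_ne_zero hw hre
  rw [T.num_eval_eq hw hne, mul_left_comm] at h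
  have h1 : ω * T.stab (1 - w⁻¹) = 1 := by
    have := mul_left_cancel₀ hne ((mul_one _).trans h)
    exact this.symm
  have h2 := congrArg norm h1
  rw [norm_mul, norm_one] at h2
  nlinarith [(hstab _ hre).2, norm_nonneg ω, norm_nonneg (T.stab (1 - w⁻¹))]

theorem IsAStable.differentiableOn_stab (hstab : T.IsAStable) :
    DifferentiableOn ℂ T.stab {z | z.re < 0} := by
  have h1 : ∀ z : ℂ, z.re < 0 → 1 - z ≠ 0 := fun z hz h => by
    have := congrArg Complex.re h
    simp at this
    linarith
  have heq : Set.EqOn T.stab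
      (fun z => 1 + ((1 - z)⁻¹ - 1) * T.weightSum.eval (1 - z)⁻¹ / T.den.eval (1 - z)⁻¹)
      {z | z.re < 0} := by
    intro z hz
    have hz' := inv_ne_zero (h1 z hz)
    have hz0 : z.re < 0 := hz
    have := T.stab_eq hz' (hstab.den_eval_ne_zero hz' (by simpa using hz0.le))
    simpa using this
  refine DifferentiableOn.congr (fun z hz => ?_) heq
  have hz0 : z.re < 0 := hz
  have hi : DifferentiableAt ℂ (fun z : ℂ => (1 - z)⁻¹) z :=
    ((differentiableAt_const _).sub differentiableAt_id).inv (h1 z hz)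
  have hp : ∀ p : ℂ[X], DifferentiableAt ℂ (fun z : ℂ => p.eval (1 - z)⁻¹) z := fun p =>
    p.differentiableAt.comp z hi
  exact ((((hi.sub_const 1).mul (hp _)).div (hp _) (hstab.den_eval_ne_zero
    (inv_ne_zero (h1 z hz)) (by simpa using hz0.le))).const_add 1).differentiableWithinAt

/-- By the maximum principle, `R(z) ≠ 1` in the open left half plane. -/
theorem IsAStable.stab_ne_one (hstab : T.IsAStable) (hinv : IsUnit T.a.det)
    (hinf : ‖T.stabInfty‖ < 1) {z : ℂ} (hz : z.re < 0) : T.stab z ≠ 1 := by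
  intro h
  have hconst := Complex.eqOn_of_isPreconnected_of_isMaxOn_norm
    (convex_halfSpace_re_lt 0).isPreconnected (isOpen_lt Complex.continuous_re continuous_const)
    hstab.differentiableOn_stab hz (fun y (hy : y.re < 0) => by
      simpa [h] using (hstab y hy.le).2)
  -- R would be constantly 1 in the half plane; these points go to infinity inside it and force R(∞)
  -- = 1.
  have hlim : Filter.Tendsto (fun n : ℕ => -((n : ℂ) + 1)) Filter.atTop (Filter.cocompact ℂ) := by
    rw [← Metric.cobounded_eq_cocompact, ← tendsto_norm_atTop_iff_cobounded]
    refine Filter.tendsto_atTop_mono (fun n => ?_) tendsto_natCast_atTop_atTop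
    have : ‖-((n : ℂ) + 1)‖ = n + 1 := by
      rw [norm_neg]; exact_mod_cast Complex.norm_natCast (n + 1)
    rw [this]; linarith
  have h1 := (T.tendsto_stab_stabInfty hinv).comp hlim
  have h2 : T.stab ∘ (fun n : ℕ => -((n : ℂ) + 1)) = fun _ => 1 := by
    funext n
    have hn : (-((n : ℂ) + 1)).re < 0 := by
      simp only [Complex.neg_re, Complex.add_re, Complex.natCast_re, Complex.one_re]
      have : (0 : ℝ) ≤ n := n.cast_nonneg
      linarith
    exact (hconst hn).trans h
  rw [h2] at h1
  rw [← tendsto_nhds_unique tendsto_const_nhds h1, norm_one] at hinf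
  exact lt_irrefl _ hinf

theorem mem_sector_of_re_pos {θ : ℝ} (hθ : Real.pi / 2 < θ) {μ : ℂ} (h : 0 ≤ μ.re) (h0 : μ ≠ 0) :
    μ ∈ sector θ :=
  ⟨h0, (Complex.abs_arg_le_pi_div_two_iff.2 h).trans_lt hθ⟩

theorem IsAStable.mem_sector_of_den_eval_eq (hstab : T.IsAStable) {θ : ℝ}
    (hθ : Real.pi / 2 < θ) {ω w : ℂ} (hω : ‖ω‖ < 1)
    (hw : w ≠ 0) (h : T.den.eval w = ω * T.num.eval w) : 1 - w⁻¹ ∈ sector θ := by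
  have := hstab.re_pos_of_den_eval_eq hω hw h
  refine mem_sector_of_re_pos hθ this.le fun h0 => ?_
  rw [h0] at this
  exact lt_irrefl _ this

/-- A zero with Re z < 0 would give R(z) = 1 there. What remains is the closed right half plane,
which lies in the sector except for z = 0, that is w = 1, where the order condition gives the value
1. -/
theorem IsAStable.mem_sector_of_weightSum_eval_eq_zero (hstab : T.IsAStable)
    (hord : T.HasOrderAtLeastOne) (hinv : IsUnit T.a.det) (hinf : ‖T.stabInfty‖ < 1) {θ : ℝ}
    (hθ : Real.pi / 2 < θ) {w : ℂ} (hw : w ≠ 0) (h : T.weightSum.eval w = 0) :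
    1 - w⁻¹ ∈ sector θ := by
  refine mem_sector_of_re_pos hθ ?_ fun h0 => ?_
  · by_contra! hre
    refine hstab.stab_ne_one hinv hinf hre ?_
    rw [T.stab_eq hw (hstab.den_eval_ne_zero hw hre.le), h, mul_zero, zero_div, add_zero]
  · have : w = 1 := by rw [sub_eq_zero, eq_comm, inv_eq_one] at h0; exact h0
    rw [this, hord.weightSum_eval_one] at h
    exact one_ne_zero h

end ButcherTableau

/-! ### The O(1/(m+1)) kernel bound, uniformly in the stepsize -/

section StabilityBound

open Polynomial

/-- Since R - 1 = den⁻¹ (X - 1) `weightSum` and `weightSum` is invertible at `S`, the second factor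
is R - 1 times the bounded element `G * aeval S (T.weightPoly i)`, and Ritt's estimate applies. -/
theorem HasSectorialResolvent.exists_stability_bound {𝔸 : Type*} [NormedRing 𝔸]
    [NormedAlgebra ℂ 𝔸] [CompleteSpace 𝔸] {θ K : ℝ} {S : 𝔸} (hS : HasSectorialResolvent θ K S)
    (hK : 1 ≤ K) (hθ : Real.pi / 2 < θ) {s : ℕ} (T : ButcherTableau s)
    (hord : T.HasOrderAtLeastOne) (hstab : T.IsAStable) (hinv : IsUnit T.a.det)
    (hinf : ‖T.stabInfty‖ < 1) :
    ∃ Qi : 𝔸, Qi * aeval S T.den = 1 ∧ aeval S T.den * Qi = 1 ∧ ∃ c : ℝ, ∀ (m : ℕ) (i : Fin s),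
      ‖(Qi * aeval S T.num) ^ m * (Qi * aeval S ((X - 1) * T.weightPoly i))‖ ≤ c / (m + 1) := by
  obtain ⟨Qi, hQi, hQi', c, hc⟩ := hS.exists_inverse_one_sub_smul hK
    (T.norm_num_eval_zero_lt hinv hinf) T.num_eval_one T.den_eval_one
    fun ω hω r hr h => hstab.mem_sector_of_den_eval_eq hθ hω hr h
  obtain ⟨c', hc'⟩ := exists_norm_pow_mul_sub_one_le_div hc
  have h0 : T.weightSum.eval 0 ≠ 0 := by
    rw [T.weightSum_eval_zero hinv]
    refine mul_ne_zero (T.den_eval_zero_ne_zero hinv) (sub_ne_zero.2 fun h => ?_)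
    rw [← h, norm_one] at hinf
    exact lt_irrefl _ hinf
  have hne : T.weightSum ≠ 0 := fun h => h0 (by rw [h, eval_zero])
  obtain ⟨δ, hδ, hδr⟩ : ∃ δ > 0, ∀ w : ℂ, ‖w‖ < δ → T.weightSum.eval w ≠ 0 := by
    simpa using Metric.eventually_nhds_iff.1
      (T.weightSum.continuous.continuousAt.eventually_ne (x := 0) h0)
  obtain ⟨G, -, hG, -⟩ := hS.exists_inverse_aeval hK hδ hne le_rfl fun r hr =>
    ⟨not_lt.1 fun h => hδr r h hr,
      hstab.mem_sector_of_weightSum_eval_eq_zero hord hinv hinf hθ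
        (fun h => h0 (h ▸ hr)) hr⟩
  refine ⟨Qi, hQi, hQi', c' * ∑ i, ‖G * aeval S (T.weightPoly i)‖, fun m i => ?_⟩
  have h1 : Qi * aeval S T.num - 1 = Qi * aeval S (X - 1 : ℂ[X]) * aeval S T.weightSum := by
    rw [ButcherTableau.num, map_add, mul_add, hQi, map_mul, mul_assoc, add_sub_cancel_left]
  have h2 : Qi * aeval S ((X - 1) * T.weightPoly i) =
      (Qi * aeval S T.num - 1) * (G * aeval S (T.weightPoly i)) := by
    rw [h1, mul_assoc (Qi * _), ← mul_assoc _ G, hG, one_mul, map_mul, mul_assoc]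
  rw [h2, ← mul_assoc, mul_div_right_comm]
  refine (norm_mul_le _ _).trans (mul_le_mul (hc' m) ?_ (norm_nonneg _)
    ((norm_nonneg _).trans (hc' m)))
  exact Finset.single_le_sum (f := fun i => ‖G * aeval S (T.weightPoly i)‖)
    (fun _ _ => norm_nonneg _) (Finset.mem_univ i)

variable {X : Type*} [NormedAddCommGroup X] [NormedSpace ℂ X]

/-- The bounded operator `S` is `(1 - τ A)⁻¹`. -/
def IsEulerResolvent (A : X →ₗ.[ℂ] X) (τ : ℝ) (S : X →L[ℂ] X) : Prop :=
  (∀ x : A.domain, S ((x : X) - (τ : ℂ) • A x) = x) ∧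
    ∀ y : X, ∃ h : S y ∈ A.domain, S y - (τ : ℂ) • A ⟨S y, h⟩ = y

/-- The resolvent equation. -/
theorem IsResolventAt.comp_eq {A : X →ₗ.[ℂ] X} {μ ν : ℂ} {S R : X →L[ℂ] X}
    (hS : IsResolventAt A μ S) (hR : IsResolventAt A ν R) :
    (μ - ν) • (S * R) = R - S := by
  ext y
  obtain ⟨h, hy⟩ := hR.2 y
  have h1 := hS.1 ⟨R y, h⟩
  have h2 : μ • R y - A ⟨R y, h⟩ = (μ - ν) • R y + y := by
    rw [sub_eq_iff_eq_add] at hy ⊢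
    rw [add_assoc, ← hy, sub_smul, sub_add_cancel]
  change S (μ • R y - A ⟨R y, h⟩) = R y at h1
  rw [h2, map_add, map_smul] at h1
  exact eq_sub_of_add_eq h1

theorem ofReal_inv_mem_sector {θ τ : ℝ} (hτ : 0 < τ) {μ : ℂ}
    (hμ : μ ∈ sector θ) : (τ : ℂ)⁻¹ * μ ∈ sector θ := by
  refine ⟨mul_ne_zero (inv_ne_zero (by exact_mod_cast hτ.ne')) hμ.1, ?_⟩
  rw [← Complex.ofReal_inv, Complex.arg_real_mul _ (inv_pos.2 hτ)]
  exact hμ.2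

theorem IsResolventAt.norm_smul_le {A : X →ₗ.[ℂ] X} {μ : ℂ} {S : X →L[ℂ] X} {M : ℝ}
    (hS : IsResolventAt A μ S) (hM : ∀ (y : X) (h : S y ∈ A.domain), ‖A ⟨S y, h⟩‖ ≤ M * ‖y‖) :
    ‖μ • S‖ ≤ 1 + |M| := by
  refine ContinuousLinearMap.opNorm_le_bound _ (by positivity) fun y => ?_
  obtain ⟨h, hy⟩ := hS.2 y
  have h1 : (μ • S) y = y + A ⟨S y, h⟩ :=
    sub_eq_iff_eq_add.1 hy
  rw [h1, add_mul, one_mul]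
  exact (norm_add_le _ _).trans (add_le_add_right ((hM y h).trans
    (mul_le_mul_of_nonneg_right (le_abs_self M) (norm_nonneg y))) _)

/-- The sector is invariant under multiplication by 1/τ, so one constant serves every τ. With W =
(μ/τ - A)⁻¹, the operator τ⁻¹W is (μ - τA)⁻¹, and the required inverse is 1 + (1 - μ)τ⁻¹W. -/
theorem IsUniformlyBoundedOnSector.exists_isEulerResolvent {A : X →ₗ.[ℂ] X} {θ : ℝ}
    (hA : IsUniformlyBoundedOnSector A θ) (hθ : Real.pi / 2 < θ) :
    ∃ K : ℝ, 1 ≤ K ∧ ∀ τ : ℝ, 0 < τ → ∃ S : X →L[ℂ] X, IsEulerResolvent A τ S ∧ ‖S‖ ≤ K ∧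
      HasSectorialResolvent θ K S := by
  obtain ⟨M, hM⟩ := hA
  refine ⟨2 + |M|, by linarith [abs_nonneg M], fun τ hτ => ?_⟩
  have hτ0 : (τ : ℂ) ≠ 0 := by exact_mod_cast hτ.ne'
  have h1s : (1 : ℂ) ∈ sector θ := ⟨one_ne_zero, by
    rw [Complex.arg_one, abs_zero]; linarith [Real.pi_pos]⟩
  obtain ⟨R, hR, hRM⟩ := hM _ (ofReal_inv_mem_sector hτ h1s)
  rw [mul_one] at hR
  have hRb := hR.norm_smul_le hRM
  refine ⟨(τ : ℂ)⁻¹ • R, ⟨fun x => ?_, fun y => ?_⟩, by linarith, fun μ hμ => ?_⟩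
  · conv_rhs => rw [← hR.1 x]
    rw [smul_apply, ← map_smul, smul_sub, smul_smul, inv_mul_cancel₀ hτ0,
      one_smul]
  · obtain ⟨h, hy⟩ := hR.2 y
    refine ⟨A.domain.smul_mem _ h, ?_⟩
    conv_rhs => rw [← hy]
    have : A ⟨((τ : ℂ)⁻¹ • R) y, A.domain.smul_mem _ h⟩ = (τ : ℂ)⁻¹ • A ⟨R y, h⟩ := by
      rw [← A.map_smul]; rfl
    rw [this, smul_smul, mul_inv_cancel₀ hτ0, one_smul]
    rfl
  · obtain ⟨W, hW, hWM⟩ := hM _ (ofReal_inv_mem_sector hτ hμ)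
    have hWb := hW.norm_smul_le hWM
    set V : X →L[ℂ] X := 1 + (1 - μ) • ((τ : ℂ)⁻¹ • W) with hV
    have hc1 := hW.comp_eq hR
    have hc2 := hR.comp_eq hW
    -- Stated for a general product so that the resolvent equation in either order, WR or RW, yields
    -- the left and the right inverse.
    have key : ∀ P Q : X →L[ℂ] X, ((τ : ℂ)⁻¹ * μ - (τ : ℂ)⁻¹) • (P * Q) = R - W →
        (1 - μ) • ((τ : ℂ)⁻¹ • W) + (μ - 1) • ((τ : ℂ)⁻¹ • R) +
          ((1 - μ) * (μ - 1) * (τ : ℂ)⁻¹ * (τ : ℂ)⁻¹) • (P * Q) = 0 := by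
      intro P Q h
      have : ((1 - μ) * (μ - 1) * (τ : ℂ)⁻¹ * (τ : ℂ)⁻¹) • (P * Q) =
          ((1 - μ) * (τ : ℂ)⁻¹) • (R - W) := by
        rw [← h, smul_smul]; congr 1; ring
      rw [this]
      module
    refine ⟨V, ?_, ?_, ?_⟩
    · have := key W R hc1
      rw [hV, add_mul, one_mul, mul_add, mul_one, smul_mul_assoc, smul_mul_assoc, mul_smul_comm,
        mul_smul_comm]
      rw [← sub_eq_zero, ← this]
      module
    · have := key R W (by rw [← neg_sub, neg_smul, hc2, neg_sub])
      rw [hV, add_mul, one_mul, mul_add, mul_one, smul_mul_assoc, smul_mul_assoc, mul_smul_comm,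
        mul_smul_comm]
      rw [← sub_eq_zero, ← this]
      module
    · have h2 : ‖V‖ ≤ 1 + ‖1 - μ‖ * ‖(τ : ℂ)⁻¹ • W‖ := by
        refine (norm_add_le _ _).trans (add_le_add ContinuousLinearMap.norm_id_le ?_)
        exact norm_smul_le (1 - μ) ((τ : ℂ)⁻¹ • W)
      have h3 : ‖(τ : ℂ)⁻¹ • W‖ * ‖μ‖ ≤ 1 + |M| := by
        rw [mul_comm, ← norm_smul, smul_smul, mul_comm]; exact hWb
      have h4 : ‖1 - μ‖ ≤ 1 + ‖μ‖ := (norm_sub_le _ _).trans (by rw [norm_one])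
      calc ‖V‖ * ‖μ‖ ≤ (1 + ‖1 - μ‖ * ‖(τ : ℂ)⁻¹ • W‖) * ‖μ‖ := by gcongr
        _ = ‖μ‖ + ‖1 - μ‖ * (‖(τ : ℂ)⁻¹ • W‖ * ‖μ‖) := by ring
        _ ≤ (1 + ‖μ‖) + (1 + ‖μ‖) * (1 + |M|) := by gcongr; linarith
        _ = _ := by ring

/-- All bounds are uniform in the stepsize `τ`: they hold in the Banach algebra of bounded
functions of `τ`. -/
theorem IsUniformlyBoundedOnSector.exists_uniform_stability_bound [CompleteSpace X]
    {A : X →ₗ.[ℂ] X} {θ : ℝ} (hA : IsUniformlyBoundedOnSector A θ) (hθ : Real.pi / 2 < θ)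
    {s : ℕ} (T : ButcherTableau s) (hord : T.HasOrderAtLeastOne) (hstab : T.IsAStable)
    (hinv : IsUnit T.a.det) (hinf : ‖T.stabInfty‖ < 1) :
    ∃ S Qi : ℝ → X →L[ℂ] X,
      (∀ τ, 0 < τ → IsEulerResolvent A τ (S τ) ∧
        Qi τ * aeval (S τ) T.den = 1 ∧ aeval (S τ) T.den * Qi τ = 1) ∧
      (∃ c : ℝ, ∀ τ, 0 < τ → ∀ (m : ℕ) (i : Fin s), ‖(Qi τ * aeval (S τ) T.num) ^ m *
        (Qi τ * aeval (S τ) ((Polynomial.X - 1) * T.weightPoly i))‖ ≤ c / (m + 1)) ∧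
      ∀ p : ℂ[X], ∃ c : ℝ, ∀ τ, 0 < τ → ‖Qi τ * aeval (S τ) p‖ ≤ c := by
  obtain ⟨K, hK, hS⟩ := hA.exists_isEulerResolvent hθ
  choose! S hS hSK hSV using hS
  let ι := {τ : ℝ // 0 < τ}
  -- The discrete topology makes every bounded family of operators indexed by τ a bounded continuous
  -- function.
  let _ : TopologicalSpace ι := ⊥
  have : DiscreteTopology ι := ⟨rfl⟩
  let Sb : BoundedContinuousFunction ι (X →L[ℂ] X) :=
    BoundedContinuousFunction.ofNormedAddCommGroupDiscrete (fun τ => S τ) K fun τ => hSK τ τ.2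
  have hSb : HasSectorialResolvent θ K Sb := by
    intro μ hμ
    have hμ0 : 0 < ‖μ‖ := norm_pos_iff.2 hμ.1
    choose! V hV hV' hVb using fun (τ : ℝ) (hτ : 0 < τ) => hSV τ hτ μ hμ
    have hVb' : ∀ τ : ι, ‖V τ‖ ≤ K * (1 + ‖μ‖) / ‖μ‖ := fun τ => by
      rw [le_div_iff₀ hμ0]; exact hVb τ τ.2
    refine ⟨BoundedContinuousFunction.ofNormedAddCommGroupDiscrete (fun τ => V τ) _ hVb',
      ?_, ?_, ?_⟩
    · ext1 τ; exact hV τ τ.2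
    · ext1 τ; exact hV' τ τ.2
    · rw [← le_div_iff₀ hμ0]
      exact (BoundedContinuousFunction.norm_le (by positivity)).2 hVb'
  obtain ⟨Qi, hQi, hQi', c, hc⟩ := hSb.exists_stability_bound hK hθ T hord hstab hinv hinf
  let ev : ι → BoundedContinuousFunction ι (X →L[ℂ] X) →ₐ[ℂ] (X →L[ℂ] X) := fun τ =>
    { toFun := fun f => f τ
      map_one' := rfl
      map_mul' := fun _ _ => rfl
      map_zero' := rfl
      map_add' := fun _ _ => rfl
      commutes' := fun _ => rfl }
  have hev : ∀ (p : ℂ[X]) (τ : ι), ev τ (aeval Sb p) = aeval (S τ) p := fun p τ =>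
    (aeval_algHom_apply (ev τ) Sb p).symm
  -- The value 0 for τ ≤ 0 is arbitrary; all claims concern τ > 0.
  let q : ℝ → X →L[ℂ] X := fun τ => if h : 0 < τ then Qi ⟨τ, h⟩ else 0
  have hq : ∀ τ : ι, q τ = ev τ Qi := fun τ => dif_pos τ.2
  have hle : ∀ (f : BoundedContinuousFunction ι (X →L[ℂ] X)) (τ : ι), ‖ev τ f‖ ≤ ‖f‖ := fun f τ =>
    f.norm_coe_le_norm τ
  refine ⟨S, q, fun τ hτ => ⟨hS τ hτ, ?_, ?_⟩, ⟨c, fun τ hτ m i => ?_⟩,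
    fun p => ⟨‖Qi * aeval Sb p‖, fun τ hτ => ?_⟩⟩ <;> lift τ to ι using hτ
  · rw [hq, ← hev, ← map_mul, hQi, map_one]
  · rw [hq, ← hev, ← map_mul, hQi', map_one]
  · simp only [hq, ← hev, ← map_mul, ← map_pow]
    exact (hle _ τ).trans (hc m i)
  · simp only [hq, ← hev, ← map_mul]
    exact hle _ τ

end StabilityBound

/-! ### Solving one Runge–Kutta step -/

section RungeKuttaSteps

open Polynomial

variable {X : Type*} [NormedAddCommGroup X] [NormedSpace ℂ X]

theorem IsEulerResolvent.mem_domain {A : X →ₗ.[ℂ] X} {τ : ℝ} {S : X →L[ℂ] X}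
    (hS : IsEulerResolvent A τ S) (y : X) : S y ∈ A.domain :=
  (hS.2 y).1

theorem IsEulerResolvent.smul_apply {A : X →ₗ.[ℂ] X} {τ : ℝ} {S : X →L[ℂ] X}
    (hS : IsEulerResolvent A τ S) {x : A.domain} {y : X} (h : (x : X) = S y) :
    (τ : ℂ) • A x = x - y := by
  obtain ⟨hy, hy'⟩ := hS.2 y
  have : x = ⟨S y, hy⟩ := Subtype.ext h
  rw [this, eq_sub_iff_add_eq', ← eq_sub_iff_add_eq, eq_comm]
  exact hy'

variable {s : ℕ}

/-- The action of a matrix of polynomials in the operator `S` on a vector. -/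
def polyMulVec (S : X →L[ℂ] X) (M : Matrix (Fin s) (Fin s) ℂ[X]) (v : Fin s → X) : Fin s → X :=
  fun i => ∑ j, aeval S (M i j) (v j)

theorem polyMulVec_mul (S : X →L[ℂ] X) (M N : Matrix (Fin s) (Fin s) ℂ[X]) (v : Fin s → X) :
    polyMulVec S (M * N) v = polyMulVec S M (polyMulVec S N v) := by
  funext i
  simp only [polyMulVec, Matrix.mul_apply, map_sum, sum_apply, map_mul,
    mul_apply_eq_comp]
  exact Finset.sum_comm

theorem polyMulVec_smul_one (S : X →L[ℂ] X) (p : ℂ[X]) (v : Fin s → X) :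
    polyMulVec S (p • (1 : Matrix (Fin s) (Fin s) ℂ[X])) v = fun i => aeval S p (v i) := by
  funext i
  simp only [polyMulVec, Matrix.smul_apply, Matrix.one_apply, smul_eq_mul, mul_ite, mul_one,
    mul_zero]
  rw [Finset.sum_eq_single i (fun j _ hj => by simp [hj.symm]) (by simp), if_pos rfl]

variable (T : ButcherTableau s)

/-- For stages U = SY one has τAU = SY - Y, so the right-hand side is what the stage equations leave
once the data are moved to the other side. They become a linear system for Y with this matrix. -/
theorem polyMulVec_stageMatrix (S : X →L[ℂ] X) (v : Fin s → X) (i : Fin s) :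
    polyMulVec S T.stageMatrix v i =
      S (v i) - ∑ j, (T.a i j : ℂ) • (S (v j) - v j) := by
  have h : ∀ j, aeval S (T.stageMatrix i j) (v j) =
      (if i = j then S (v j) else 0) - (T.a i j : ℂ) • (S (v j) - v j) := by
    intro j
    by_cases hij : i = j
    · simp [ButcherTableau.stageMatrix, hij, ButcherTableau.aC, Algebra.algebraMap_eq_smul_one]
      module
    · simp [ButcherTableau.stageMatrix, hij, ButcherTableau.aC, Algebra.algebraMap_eq_smul_one]
      module
  simp only [polyMulVec, h, Finset.sum_sub_distrib, Finset.sum_ite_eq, Finset.mem_univ, if_true]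

/-- The vector `Y = (1 - τ A) U` for the stages `U` of one step from `u`. -/
def stageVec (S Qi : X →L[ℂ] X) (τ : ℝ) (u : X) (F : Fin s → X) (i : Fin s) : X :=
  Qi (polyMulVec S T.stageMatrix.adjugate (fun j => u + (τ : ℂ) • ∑ k, (T.a j k : ℂ) • F k) i)

variable {T} {S Qi : X →L[ℂ] X}

theorem aeval_apply_inverse (h : Qi * aeval S T.den = 1) (h' : aeval S T.den * Qi = 1)
    (p : ℂ[X]) (x : X) : aeval S p (Qi x) = Qi (aeval S p x) := by
  have hd : aeval S T.den * aeval S p = aeval S p * aeval S T.den := by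
    rw [← map_mul, mul_comm, map_mul]
  have h1 : aeval S p * Qi = Qi * aeval S p := by
    rw [← one_mul (aeval S p * Qi), ← h, mul_assoc, ← mul_assoc _ _ Qi, hd, mul_assoc, h', mul_one]
  exact DFunLike.congr_fun h1 x

/-- Cramer's rule over the commutative ring ℂ[X], evaluated at `S`, where `Qi` inverts the
determinant. -/
theorem polyMulVec_stageMatrix_eq_iff (h : Qi * aeval S T.den = 1) (h' : aeval S T.den * Qi = 1)
    (v r : Fin s → X) :
    polyMulVec S T.stageMatrix v = r ↔
      v = fun i => Qi (polyMulVec S T.stageMatrix.adjugate r i) := by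
  have happ : ∀ x, Qi (aeval S T.den x) = x := fun x => DFunLike.congr_fun h x
  have happ' : ∀ x, aeval S T.den (Qi x) = x := fun x => DFunLike.congr_fun h' x
  constructor
  · rintro rfl
    rw [← polyMulVec_mul, Matrix.adjugate_mul, polyMulVec_smul_one]
    funext i
    exact (happ _).symm
  · rintro rfl
    have hcomm := aeval_apply_inverse (T := T) h h'
    have : polyMulVec S T.stageMatrix (fun i => Qi (polyMulVec S T.stageMatrix.adjugate r i)) =
        fun i => Qi (polyMulVec S T.stageMatrix (polyMulVec S T.stageMatrix.adjugate r) i) := by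
      funext i
      simp only [polyMulVec, map_sum, hcomm]
    rw [this, ← polyMulVec_mul, Matrix.mul_adjugate, polyMulVec_smul_one]
    funext i
    exact happ _

variable {A : X →ₗ.[ℂ] X} {τ : ℝ}

theorem IsEulerResolvent.stage_iff (hS : IsEulerResolvent A τ S)
    (h : Qi * aeval S T.den = 1) (h' : aeval S T.den * Qi = 1) (u : X) (F : Fin s → X)
    (U : Fin s → A.domain) :
    (∀ i, (U i : X) = u + (τ : ℂ) • ∑ j, (T.a i j : ℂ) • (A (U j) + F j)) ↔
      ∀ i, (U i : X) = S (stageVec T S Qi τ u F i) := by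
  have key : ∀ Y : Fin s → X, (∀ i, (U i : X) = S (Y i)) →
      ((∀ i, (U i : X) = u + (τ : ℂ) • ∑ j, (T.a i j : ℂ) • (A (U j) + F j)) ↔
        Y = stageVec T S Qi τ u F) := by
    intro Y hY
    refine Iff.trans ?_ (polyMulVec_stageMatrix_eq_iff h h' Y _)
    rw [funext_iff]
    refine forall_congr' fun i => ?_
    rw [polyMulVec_stageMatrix, sub_eq_iff_eq_add, ← hY]
    have : (τ : ℂ) • ∑ j, (T.a i j : ℂ) • (A (U j) + F j) =
        (τ : ℂ) • ∑ j, (T.a i j : ℂ) • F j + ∑ j, (T.a i j : ℂ) • (S (Y j) - Y j) := by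
      simp only [smul_add, Finset.sum_add_distrib, Finset.smul_sum]
      rw [add_comm]
      congr 1
      refine Finset.sum_congr rfl fun j _ => ?_
      rw [smul_comm, hS.smul_apply (hY j), hY]
    rw [this, add_assoc]
  constructor
  · intro hU i
    have hY : ∀ i, (U i : X) = S ((U i : X) - (τ : ℂ) • A (U i)) := fun i => (hS.1 (U i)).symm
    rw [← congrFun ((key _ hY).1 hU) i]
    exact hY i
  · intro hU
    exact (key _ hU).2 rfl

theorem weightPoly_mul_stageMatrix (k : Fin s) :
    ∑ j, T.weightPoly j * T.stageMatrix j k = T.den * C (T.bC k) := by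
  have h := congrFun (congrArg (Matrix.vecMul fun i => C (T.bC i))
    (Matrix.adjugate_mul T.stageMatrix)) k
  rw [← Matrix.vecMul_vecMul, Matrix.vecMul_smul, Matrix.vecMul_one] at h
  exact h

/-- The stage matrix is X - (X - 1)a; multiply by the weight row and use bᵀ adj(M) M = den bᵀ. The
resulting factor X becomes an `S` in front of the data, which keeps the step inside the domain of
`A`. -/
theorem sum_weightPoly_mul_a (k : Fin s) :
    ∑ j, (Polynomial.X - 1) * T.weightPoly j * C (T.a j k : ℂ) + T.den * C (T.bC k) =
      Polynomial.X * T.weightPoly k := by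
  rw [← weightPoly_mul_stageMatrix, ← Finset.sum_add_distrib]
  have : ∀ j, (Polynomial.X - 1) * T.weightPoly j * C (T.a j k : ℂ) + T.weightPoly j * T.stageMatrix j k =
      if j = k then Polynomial.X * T.weightPoly j else 0 := by
    intro j
    by_cases hjk : j = k
    · simp [ButcherTableau.stageMatrix, ButcherTableau.aC, hjk]; ring
    · simp [ButcherTableau.stageMatrix, ButcherTableau.aC, hjk]; ring
  simp only [this, Finset.sum_ite_eq', Finset.mem_univ, if_true]

theorem sum_b_adjugate (r : Fin s → X) :
    ∑ i, (T.b i : ℂ) • aeval S (Polynomial.X - 1 : ℂ[X]) (polyMulVec S T.stageMatrix.adjugate r i) =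
      ∑ j, aeval S ((Polynomial.X - 1) * T.weightPoly j) (r j) := by
  have h : ∀ j, aeval S ((Polynomial.X - 1) * T.weightPoly j) (r j) = ∑ i, (T.b i : ℂ) •
      aeval S (Polynomial.X - 1 : ℂ[X]) (aeval S (T.stageMatrix.adjugate i j) (r j)) := by
    intro j
    rw [ButcherTableau.weightPoly, map_mul, mul_apply_eq_comp, map_sum, sum_apply, map_sum]
    refine Finset.sum_congr rfl fun i _ => ?_
    rw [map_mul, aeval_C, Algebra.algebraMap_eq_smul_one, smul_mul_assoc, one_mul, smul_apply,
      map_smul]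
    rfl
  simp only [h, polyMulVec, map_sum, Finset.smul_sum]
  exact Finset.sum_comm

/-- One Runge--Kutta step in terms of the stability function. -/
theorem step_eq (h : Qi * aeval S T.den = 1) (h' : aeval S T.den * Qi = 1) (u : X)
    (F : Fin s → X) :
    u + ∑ i, (T.b i : ℂ) • (S (stageVec T S Qi τ u F i) - stageVec T S Qi τ u F i +
        (τ : ℂ) • F i) =
      Qi (aeval S T.num u) + (τ : ℂ) • Qi (S (∑ i, aeval S (T.weightPoly i) (F i))) := by
  have happ : ∀ x, Qi (aeval S T.den x) = x := fun x => DFunLike.congr_fun h x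
  have hcomm := aeval_apply_inverse (T := T) h h'
  set r : Fin s → X := fun j => u + (τ : ℂ) • ∑ k, (T.a j k : ℂ) • F k with hr
  have h1 : ∀ i, S (stageVec T S Qi τ u F i) - stageVec T S Qi τ u F i =
      Qi (aeval S (Polynomial.X - 1 : ℂ[X]) (polyMulVec S T.stageMatrix.adjugate r i)) := by
    intro i
    rw [← hcomm, map_sub, aeval_X, map_one]
    rfl
  have h2 : ∑ j, aeval S ((Polynomial.X - 1) * T.weightPoly j) (r j) =
      aeval S ((Polynomial.X - 1) * T.weightSum) u + (τ : ℂ) • ∑ k, aeval S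
        (∑ j, (Polynomial.X - 1) * T.weightPoly j * C (T.a j k : ℂ)) (F k) := by
    simp only [hr, map_add, Finset.sum_add_distrib]
    congr 1
    · simp only [ButcherTableau.weightSum, Finset.mul_sum, map_sum, sum_apply]
    · simp only [map_smul, ← Finset.smul_sum, map_sum, sum_apply]
      rw [Finset.sum_comm]
      congr 1
      refine Finset.sum_congr rfl fun k _ => Finset.sum_congr rfl fun j _ => ?_
      rw [map_mul _ _ (C _), aeval_C, Algebra.algebraMap_eq_smul_one, mul_smul_comm, mul_one]
      rfl
  have h3 : ∀ k, aeval S (∑ j, (Polynomial.X - 1) * T.weightPoly j * C (T.a j k : ℂ)) (F k) =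
      S (aeval S (T.weightPoly k) (F k)) - (T.b k : ℂ) • aeval S T.den (F k) := by
    intro k
    rw [eq_sub_of_add_eq (sum_weightPoly_mul_a (T := T) k), map_sub, map_mul, map_mul, aeval_X,
      aeval_C, Algebra.algebraMap_eq_smul_one, mul_smul_comm, mul_one]
    rfl
  simp only [smul_add, Finset.sum_add_distrib, h1]
  have h4 : ∑ i, (T.b i : ℂ) • Qi (aeval S (Polynomial.X - 1 : ℂ[X])
      (polyMulVec S T.stageMatrix.adjugate r i)) =
      Qi (∑ j, aeval S ((Polynomial.X - 1) * T.weightPoly j) (r j)) := by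
    rw [← sum_b_adjugate, map_sum]
    simp only [map_smul]
  have h5 : Qi (aeval S T.num u) = u + Qi (aeval S ((Polynomial.X - 1) * T.weightSum) u) := by
    rw [ButcherTableau.num, map_add, add_apply, map_add, happ]
  rw [h4, h2, h5]
  simp only [h3, Finset.sum_sub_distrib]
  simp only [map_add, map_smul, map_sub, map_sum, happ]
  rw [add_assoc, add_assoc]
  congr 2
  rw [smul_sub, Finset.smul_sum (r := (τ : ℂ)) (f := fun i => (T.b i : ℂ) • F i)]
  simp only [smul_comm (τ : ℂ) (T.b _ : ℂ)]
  rw [sub_add_cancel]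

theorem aeval_apply_self (S : X →L[ℂ] X) (p : ℂ[X]) (x : X) :
    aeval S p (S x) = S (aeval S p x) := by
  have : aeval S (p * Polynomial.X) x = aeval S (Polynomial.X * p) x := by rw [mul_comm]
  simpa only [map_mul, aeval_X, mul_apply_eq_comp] using this

theorem aeval_X_sub_one_mul_apply (S : X →L[ℂ] X) (p : ℂ[X]) (x : X) :
    aeval S ((Polynomial.X - 1) * p) x = S (aeval S p x) - aeval S p x := by
  rw [map_mul, map_sub, aeval_X, map_one]
  rfl

theorem step_eq_apply (h : Qi * aeval S T.den = 1) (h' : aeval S T.den * Qi = 1) (v w : X) :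
    Qi (aeval S T.num (S v)) + (τ : ℂ) • Qi (S w) =
      S (Qi (aeval S T.num v) + (τ : ℂ) • Qi w) := by
  have hQS : ∀ x, Qi (S x) = S (Qi x) := fun x => by
    simpa using (aeval_apply_inverse (T := T) h h' Polynomial.X x).symm
  rw [map_add, map_smul, aeval_apply_self, hQS, hQS]

/-- A Runge--Kutta step preserves the domain of `A`. -/
theorem IsEulerResolvent.mem_domain_step (hS : IsEulerResolvent A τ S)
    (h : Qi * aeval S T.den = 1) (h' : aeval S T.den * Qi = 1) (u : A.domain) (w : X) :
    Qi (aeval S T.num u) + (τ : ℂ) • Qi (S w) ∈ A.domain := by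
  rw [← hS.1 u, step_eq_apply h h']
  exact hS.mem_domain _

/-- The recursion for `A u_n`. -/
theorem IsEulerResolvent.apply_step (hS : IsEulerResolvent A τ S) (hτ : τ ≠ 0)
    (h : Qi * aeval S T.den = 1) (h' : aeval S T.den * Qi = 1) (u u' : A.domain) (F : Fin s → X)
    (hu : (u' : X) = Qi (aeval S T.num u) +
      (τ : ℂ) • Qi (S (∑ i, aeval S (T.weightPoly i) (F i)))) :
    A u' = Qi (aeval S T.num (A u)) +
      ∑ i, Qi (aeval S ((Polynomial.X - 1) * T.weightPoly i) (F i)) := by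
  have hτ0 : (τ : ℂ) ≠ 0 := by exact_mod_cast hτ
  have hu1 := hu
  -- Writing u = S(u - τAu) exhibits u' as S y, hence τAu' = u' - y.
  rw [← hS.1 u, step_eq_apply h h'] at hu1
  refine smul_right_injective X hτ0 ?_
  change (τ : ℂ) • A u' = (τ : ℂ) • _
  rw [hS.smul_apply hu1, hu]
  simp only [aeval_X_sub_one_mul_apply, map_sub, map_sum, map_smul, smul_add,
    Finset.sum_sub_distrib, smul_sub]
  abel

/-- The formula for `A U_n`. -/
theorem IsEulerResolvent.apply_stage (hS : IsEulerResolvent A τ S) (hτ : τ ≠ 0)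
    (h : Qi * aeval S T.den = 1) (h' : aeval S T.den * Qi = 1) (u : A.domain) (F : Fin s → X)
    (U : Fin s → A.domain) (hU : ∀ i, (U i : X) = S (stageVec T S Qi τ u F i)) (i : Fin s) :
    A (U i) = ∑ j, Qi (aeval S (Polynomial.X * T.stageMatrix.adjugate i j) (A u)) +
      ∑ j, ∑ k, (T.a j k : ℂ) •
        Qi (aeval S ((Polynomial.X - 1) * T.stageMatrix.adjugate i j) (F k)) := by
  have hτ0 : (τ : ℂ) ≠ 0 := by exact_mod_cast hτ
  refine smul_right_injective X hτ0 ?_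
  change (τ : ℂ) • A (U i) = (τ : ℂ) • _
  have h1 : ∀ x, S (Qi x) - Qi x = Qi (S x - x) := fun x => by
    have := aeval_apply_inverse (T := T) h h' Polynomial.X x
    rw [aeval_X] at this
    rw [this, map_sub]
  -- This trades the factor X - 1 acting on u for τX acting on Au, so that τ cancels.
  have h2 : S (u : X) - u = (τ : ℂ) • S (A u) := by
    calc S (u : X) - u = S (u : X) - S ((u : X) - (τ : ℂ) • A u) := by rw [hS.1 u]
      _ = (τ : ℂ) • S (A u) := by rw [← map_sub, sub_sub_cancel, map_smul]
  have h3 : ∀ j, aeval S ((Polynomial.X - 1) * T.stageMatrix.adjugate i j) (u : X) =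
      (τ : ℂ) • aeval S (Polynomial.X * T.stageMatrix.adjugate i j) (A u) := by
    intro j
    rw [aeval_X_sub_one_mul_apply, ← aeval_apply_self, ← map_sub, h2, map_smul, aeval_apply_self,
      map_mul, aeval_X]
    rfl
  rw [hS.smul_apply (hU i), hU i, stageVec, h1, polyMulVec, map_sum, ← Finset.sum_sub_distrib,
    map_sum]
  simp only [← aeval_X_sub_one_mul_apply]
  simp only [map_add, h3, map_smul, map_sum, Finset.sum_add_distrib, smul_add, Finset.smul_sum]

end RungeKuttaSteps

/-! ### Finite ℓ^p norms and Young's inequality -/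

section SeqNorm

variable {E E' : Type*} [NormedAddCommGroup E] [NormedAddCommGroup E'] {p : ℝ≥0∞} {N : ℕ}

theorem seqNorm_top (v : ℕ → E) : seqNorm ∞ N v = ⨆ n : Fin N, ‖v n‖ :=
  PiLp.norm_eq_ciSup _

theorem seqNorm_eq_sum (hp : 1 ≤ p) (hp' : p ≠ ∞) (v : ℕ → E) :
    seqNorm p N v = (∑ n ∈ Finset.range N, ‖v n‖ ^ p.toReal) ^ (1 / p.toReal) := by
  rw [Finset.sum_range (fun n => ‖v n‖ ^ p.toReal)]
  exact PiLp.norm_eq_sum (ENNReal.toReal_pos (zero_lt_one.trans_le hp).ne' hp') _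

theorem seqNorm_nonneg (hp : 1 ≤ p) (v : ℕ → E) : 0 ≤ seqNorm p N v := by
  have : Fact (1 ≤ p) := ⟨hp⟩
  exact norm_nonneg _

theorem seqNorm_mono (hp : 1 ≤ p) {v : ℕ → E} {w : ℕ → E'} (h : ∀ n < N, ‖v n‖ ≤ ‖w n‖) :
    seqNorm p N v ≤ seqNorm p N w := by
  by_cases hp' : p = ∞
  · subst hp'
    rw [seqNorm_top, seqNorm_top]
    exact ciSup_mono (Set.finite_range _).bddAbove fun n => h n n.2
  · rw [seqNorm_eq_sum hp hp', seqNorm_eq_sum hp hp']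
    gcongr with n hn
    exact h n (Finset.mem_range.1 hn)

theorem seqNorm_norm (hp : 1 ≤ p) (v : ℕ → E) : seqNorm p N (fun n => ‖v n‖) = seqNorm p N v :=
  le_antisymm (seqNorm_mono hp fun n _ => by rw [norm_norm])
    (seqNorm_mono hp fun n _ => by rw [norm_norm])

theorem seqNorm_add_le (hp : 1 ≤ p) (v w : ℕ → E) :
    seqNorm p N (fun n => v n + w n) ≤ seqNorm p N v + seqNorm p N w := by
  have : Fact (1 ≤ p) := ⟨hp⟩
  exact norm_add_le (WithLp.toLp p fun n : Fin N => v n : PiLp p fun _ : Fin N => E)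
    (WithLp.toLp p fun n : Fin N => w n : PiLp p fun _ : Fin N => E)

theorem seqNorm_zero (hp : 1 ≤ p) : seqNorm p N (fun _ => (0 : E)) = 0 := by
  have : Fact (1 ≤ p) := ⟨hp⟩
  exact norm_zero (E := PiLp p fun _ : Fin N => E)

theorem seqNorm_sum_le {ι : Type*} (hp : 1 ≤ p) (t : Finset ι) (v : ι → ℕ → E) :
    seqNorm p N (fun n => ∑ k ∈ t, v k n) ≤ ∑ k ∈ t, seqNorm p N (v k) := by
  classical
  induction t using Finset.induction_on with
  | empty => simp [seqNorm_zero hp]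
  | insert k t hk ih =>
    simp only [Finset.sum_insert hk]
    exact (seqNorm_add_le hp _ _).trans (add_le_add_right ih _)

theorem seqNorm_const_mul (hp : 1 ≤ p) {c : ℝ} (hc : 0 ≤ c) (v : ℕ → ℝ) :
    seqNorm p N (fun n => c * v n) = c * seqNorm p N v := by
  have : Fact (1 ≤ p) := ⟨hp⟩
  have h := norm_smul c (WithLp.toLp p fun n : Fin N => v n : PiLp p fun _ : Fin N => ℝ)
  rw [Real.norm_of_nonneg hc] at h
  exact h

theorem seqNorm_shift_le (hp : 1 ≤ p) (k : ℕ) (v : ℕ → E) :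
    seqNorm p N (fun n => if k ≤ n then v (n - k) else 0) ≤ seqNorm p N v := by
  by_cases hp' : p = ∞
  · subst hp'
    rw [seqNorm_top, seqNorm_top]
    refine Real.iSup_le (fun n => ?_) (Real.iSup_nonneg fun _ => norm_nonneg _)
    split_ifs with h
    · exact le_ciSup (f := fun n : Fin N => ‖v n‖) (Set.finite_range _).bddAbove
        ⟨n - k, (Nat.sub_le _ _).trans_lt n.2⟩
    · rw [norm_zero]
      exact Real.iSup_nonneg fun _ => norm_nonneg _
  · have hpos := ENNReal.toReal_pos (zero_lt_one.trans_le hp).ne' hp'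
    rw [seqNorm_eq_sum hp hp', seqNorm_eq_sum hp hp']
    refine Real.rpow_le_rpow (Finset.sum_nonneg fun _ _ => by positivity) ?_ (by positivity)
    have h0 : ∀ n, ‖if k ≤ n then v (n - k) else 0‖ ^ p.toReal =
        if k ≤ n then ‖v (n - k)‖ ^ p.toReal else 0 := by
      intro n
      split_ifs
      · rfl
      · rw [norm_zero, Real.zero_rpow hpos.ne']
    simp only [h0]
    rcases le_total N k with h | h
    · rw [Finset.sum_eq_zero]
      · exact Finset.sum_nonneg fun _ _ => by positivity
      · intro n hn
        rw [if_neg]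
        have := Finset.mem_range.1 hn
        omega
    · obtain ⟨M, rfl⟩ := Nat.exists_eq_add_of_le h
      rw [Finset.sum_range_add, Finset.sum_eq_zero, zero_add]
      · simp only [le_add_iff_nonneg_right, zero_le, if_true, Nat.add_sub_cancel_left]
        exact Finset.sum_le_sum_of_subset_of_nonneg
          (Finset.range_subset_range.2 (Nat.le_add_left _ _)) fun _ _ _ => by positivity
      · intro n hn
        rw [if_neg]
        have := Finset.mem_range.1 hn
        omega

/-- Young's inequality for a discrete convolution. -/
theorem seqNorm_le_of_convolution (hp : 1 ≤ p) {c : ℕ → ℝ} (hc : ∀ k, 0 ≤ c k) {v : ℕ → E}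
    {w : ℕ → E'} (h : ∀ n, ‖v n‖ ≤ ∑ k ∈ Finset.range (n + 1), c k * ‖w (n - k)‖) :
    seqNorm p N v ≤ (∑ k ∈ Finset.range N, c k) * seqNorm p N w := by
  rw [Finset.sum_mul]
  refine le_trans ?_ (Finset.sum_le_sum fun k _ => mul_le_mul_of_nonneg_left
    ((seqNorm_shift_le hp k fun n => ‖w n‖).trans (seqNorm_norm hp w).le) (hc k))
  simp only [← seqNorm_const_mul hp (hc _)]
  -- As n < N, the sum over k ≤ n embeds in the sum over k < N of shifts padded by zeros.
  refine le_trans (seqNorm_mono hp fun n hn => ?_) (seqNorm_sum_le hp _ _)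
  refine ((h n).trans ?_).trans (le_abs_self _)
  refine le_of_eq_of_le (Finset.sum_congr rfl fun k hk => ?_)
    (Finset.sum_le_sum_of_subset_of_nonneg (Finset.range_subset_range.2 hn) fun k _ _ => ?_)
  · rw [if_pos (Nat.lt_succ_iff.1 (Finset.mem_range.1 hk))]
  · have := hc k
    positivity

end SeqNorm

/-! ### Variation of constants and estimates for the solution -/

section Estimate

open Polynomial

variable {X : Type*} [NormedAddCommGroup X] [NormedSpace ℂ X] {s : ℕ} {T : ButcherTableau s}
  {S Qi : X →L[ℂ] X} {A : X →ₗ.[ℂ] X} {τ : ℝ}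

/-- The numerical solution in terms of the stability function. -/
theorem IsEulerResolvent.isRKSolution_iff (hS : IsEulerResolvent A τ S)
    (h : Qi * aeval S T.den = 1) (h' : aeval S T.den * Qi = 1) (f : ℝ → X) (u : ℕ → X)
    (U : ℕ → Fin s → A.domain) :
    IsRKSolution A T τ f u U ↔ u 0 = 0 ∧
      (∀ n i, (U n i : X) = S (stageVec T S Qi τ (u n) (rkData T τ f n) i)) ∧
      ∀ n, u (n + 1) = Qi (aeval S T.num (u n)) +
        (τ : ℂ) • Qi (S (∑ i, aeval S (T.weightPoly i) (rkData T τ f n i))) := by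
  simp only [IsRKSolution]
  refine and_congr_right fun _ => ?_
  have h1 : (∀ n i, (U n i : X) = u n + (τ : ℂ) • ∑ j, (T.a i j : ℂ) •
      (A (U n j) + rkData T τ f n j)) ↔
      ∀ n i, (U n i : X) = S (stageVec T S Qi τ (u n) (rkData T τ f n) i) :=
    forall_congr' fun n => hS.stage_iff h h' (u n) (rkData T τ f n) (U n)
  rw [h1]
  refine and_congr_right fun hU => forall_congr' fun n => ?_
  rw [← step_eq h h', Finset.smul_sum]
  refine Eq.congr_right (congrArg _ (Finset.sum_congr rfl fun i _ => ?_))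
  rw [smul_comm, smul_add, hS.smul_apply (hU n i), hU n i]

theorem IsEulerResolvent.existsUnique_isRKSolution (hS : IsEulerResolvent A τ S)
    (h : Qi * aeval S T.den = 1) (h' : aeval S T.den * Qi = 1) (f : ℝ → X) :
    ∃! w : (ℕ → X) × (ℕ → Fin s → A.domain), IsRKSolution A T τ f w.1 w.2 := by
  simp only [hS.isRKSolution_iff h h']
  let u : ℕ → X := fun n => Nat.rec 0 (fun n x => Qi (aeval S T.num x) +
    (τ : ℂ) • Qi (S (∑ i, aeval S (T.weightPoly i) (rkData T τ f n i)))) n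
  refine ⟨(u, fun n i => ⟨_, hS.mem_domain (stageVec T S Qi τ (u n) (rkData T τ f n) i)⟩),
    ⟨rfl, fun _ _ => rfl, fun _ => rfl⟩, ?_⟩
  rintro ⟨v, V⟩ ⟨h0, hV, hv⟩
  have huv : v = u := by
    funext n
    induction n with
    | zero => exact h0
    | succ n ih =>
      refine (hv n).trans ?_
      change Qi (aeval S T.num (v n)) + _ = _
      rw [ih]
  subst huv
  refine Prod.ext rfl ?_
  funext n i
  exact Subtype.ext (hV n i)

theorem IsEulerResolvent.mem_domain_of_isRKSolution (hS : IsEulerResolvent A τ S)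
    (h : Qi * aeval S T.den = 1) (h' : aeval S T.den * Qi = 1) {f : ℝ → X} {u : ℕ → X}
    {U : ℕ → Fin s → A.domain} (hu : IsRKSolution A T τ f u U) (n : ℕ) : u n ∈ A.domain := by
  obtain ⟨h0, -, hstep⟩ := (hS.isRKSolution_iff h h' f u U).1 hu
  induction n with
  | zero => rw [h0]; exact A.domain.zero_mem
  | succ n ih => rw [hstep]; exact hS.mem_domain_step h h' ⟨u n, ih⟩ _

/-- The discrete variation-of-constants formula for `A u_n`. -/
theorem IsEulerResolvent.apply_eq_sum (hS : IsEulerResolvent A τ S) (hτ : τ ≠ 0)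
    (h : Qi * aeval S T.den = 1) (h' : aeval S T.den * Qi = 1) {f : ℝ → X} {u : ℕ → X}
    {U : ℕ → Fin s → A.domain} (hu : IsRKSolution A T τ f u U) (hd : ∀ n, u n ∈ A.domain)
    (n : ℕ) :
    A ⟨u (n + 1), hd (n + 1)⟩ = ∑ k ∈ Finset.range (n + 1), ∑ i,
      ((Qi * aeval S T.num) ^ k * (Qi * aeval S ((Polynomial.X - 1) * T.weightPoly i)))
        (rkData T τ f (n - k) i) := by
  obtain ⟨h0, -, hstep⟩ := (hS.isRKSolution_iff h h' f u U).1 hu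
  have hrec : ∀ n, A ⟨u (n + 1), hd (n + 1)⟩ = (Qi * aeval S T.num) (A ⟨u n, hd n⟩) +
      ∑ i, (Qi * aeval S ((Polynomial.X - 1) * T.weightPoly i)) (rkData T τ f n i) := fun n =>
    hS.apply_step hτ h h' ⟨u n, hd n⟩ ⟨u (n + 1), hd (n + 1)⟩ (rkData T τ f n) (hstep n)
  induction n with
  | zero =>
    have : A ⟨u 0, hd 0⟩ = 0 := by
      rw [← A.map_zero]
      exact congrArg A (Subtype.ext h0)
    rw [hrec, this, map_zero, zero_add]
    simp
  | succ n ih =>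
    rw [hrec, ih, Finset.sum_range_succ' _ (n + 1), map_sum]
    simp only [map_sum, pow_zero, one_mul, Nat.sub_zero, pow_succ', mul_assoc,
      Nat.add_sub_add_right, mul_apply_eq_comp]

/-- For N ≥ 2, log N ≥ log 2 > 1/2, so additive constants are absorbed in log N. -/
theorem sum_range_inv_le_log {N : ℕ} (hN : 2 ≤ N) :
    1 ≤ 2 * Real.log N ∧ ∑ k ∈ Finset.range N, ((k : ℝ) + 1)⁻¹ ≤ 3 * Real.log N := by
  have h1 : Real.log 2 ≤ Real.log N := Real.log_le_log (by norm_num) (by exact_mod_cast hN)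
  have h2 := Real.log_two_gt_d9
  have h3 := harmonic_le_one_add_log N
  simp only [harmonic, Rat.cast_sum, Rat.cast_inv, Nat.cast_add, Nat.cast_one] at h3
  push_cast at h3
  constructor <;> linarith

theorem IsEulerResolvent.norm_apply_le_sum (hS : IsEulerResolvent A τ S) (hτ : τ ≠ 0)
    (h : Qi * aeval S T.den = 1) (h' : aeval S T.den * Qi = 1) {f : ℝ → X} {u : ℕ → X}
    {U : ℕ → Fin s → A.domain} (hu : IsRKSolution A T τ f u U) (hd : ∀ n, u n ∈ A.domain) {c : ℝ}
    (hc : ∀ (m : ℕ) (i : Fin s), ‖(Qi * aeval S T.num) ^ m *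
      (Qi * aeval S ((Polynomial.X - 1) * T.weightPoly i))‖ ≤ c / (m + 1)) (n : ℕ) :
    ‖A ⟨u (n + 1), hd (n + 1)⟩‖ ≤ ∑ k ∈ Finset.range (n + 1),
      s * |c| * ((k : ℝ) + 1)⁻¹ * ‖rkData T τ f (n - k)‖ := by
  rw [hS.apply_eq_sum hτ h h' hu hd]
  refine (norm_sum_le _ _).trans (Finset.sum_le_sum fun k _ => ?_)
  refine (norm_sum_le _ _).trans ?_
  have hle : ∀ i, ‖((Qi * aeval S T.num) ^ k *
      (Qi * aeval S ((Polynomial.X - 1) * T.weightPoly i))) (rkData T τ f (n - k) i)‖ ≤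
      |c| * ((k : ℝ) + 1)⁻¹ * ‖rkData T τ f (n - k)‖ := fun i => by
    refine (ContinuousLinearMap.le_opNorm _ _).trans (mul_le_mul ?_ (norm_le_pi_norm _ i)
      (norm_nonneg _) (by positivity))
    refine (hc k i).trans ?_
    rw [div_eq_mul_inv]
    exact mul_le_mul_of_nonneg_right (le_abs_self c) (by positivity)
  refine (Finset.sum_le_sum fun i _ => hle i).trans (le_of_eq ?_)
  rw [Finset.sum_const, Finset.card_univ, Fintype.card_fin, nsmul_eq_mul]
  ring

theorem IsEulerResolvent.norm_apply_stage_le (hS : IsEulerResolvent A τ S) (hτ : τ ≠ 0)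
    (h : Qi * aeval S T.den = 1) (h' : aeval S T.den * Qi = 1) (u : A.domain) (F : Fin s → X)
    (U : Fin s → A.domain) (hU : ∀ i, (U i : X) = S (stageVec T S Qi τ u F i)) {b : ℂ[X] → ℝ}
    (hb : ∀ p, ‖Qi * aeval S p‖ ≤ b p) :
    ‖fun i => A (U i)‖ ≤ (∑ i, ∑ j, |b (Polynomial.X * T.stageMatrix.adjugate i j)|) * ‖A u‖ +
      (∑ i, ∑ j, ∑ k, |T.a j k| * |b ((Polynomial.X - 1) * T.stageMatrix.adjugate i j)|) *
        ‖F‖ := by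
  refine (pi_norm_le_iff_of_nonneg (by positivity)).2 fun i => ?_
  rw [hS.apply_stage hτ h h' u F U hU]
  have hop : ∀ (q : ℂ[X]) (x : X), ‖Qi (aeval S q x)‖ ≤ |b q| * ‖x‖ := fun q x =>
    ((Qi * aeval S q).le_opNorm x).trans
      (mul_le_mul_of_nonneg_right ((hb q).trans (le_abs_self _)) (norm_nonneg x))
  refine (norm_add_le _ _).trans (add_le_add ?_ ?_)
  · refine (norm_sum_le _ _).trans ((Finset.sum_le_sum fun j _ => hop _ _).trans ?_)
    rw [← Finset.sum_mul]
    refine mul_le_mul_of_nonneg_right ?_ (norm_nonneg _)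
    exact Finset.single_le_sum (f := fun i => ∑ j,
      |b (Polynomial.X * T.stageMatrix.adjugate i j)|) (fun _ _ => by positivity)
      (Finset.mem_univ i)
  · have hle : ∀ j k, ‖(T.a j k : ℂ) • Qi (aeval S
        ((Polynomial.X - 1) * T.stageMatrix.adjugate i j) (F k))‖ ≤
        |T.a j k| * |b ((Polynomial.X - 1) * T.stageMatrix.adjugate i j)| * ‖F‖ := by
      intro j k
      rw [norm_smul, Complex.norm_real, Real.norm_eq_abs, mul_assoc]
      refine mul_le_mul_of_nonneg_left ((hop _ _).trans ?_) (abs_nonneg _)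
      exact mul_le_mul_of_nonneg_left (norm_le_pi_norm _ k) (abs_nonneg _)
    refine (norm_sum_le _ _).trans ((Finset.sum_le_sum fun j _ => (norm_sum_le _ _).trans
      (Finset.sum_le_sum fun k _ => hle j k)).trans ?_)
    have hsum : ∑ j, ∑ k, |T.a j k| * |b ((Polynomial.X - 1) * T.stageMatrix.adjugate i j)| *
        ‖F‖ = (∑ j, ∑ k, |T.a j k| * |b ((Polynomial.X - 1) * T.stageMatrix.adjugate i j)|) *
        ‖F‖ := by
      simp only [Finset.sum_mul]
    rw [hsum]
    refine mul_le_mul_of_nonneg_right ?_ (norm_nonneg _)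
    exact Finset.single_le_sum (f := fun i => ∑ j, ∑ k, |T.a j k| *
      |b ((Polynomial.X - 1) * T.stageMatrix.adjugate i j)|) (fun _ _ => by positivity)
      (Finset.mem_univ i)

/-- The stages involve Au_n and the kernel bound Au_{n+1}; Au_0 = 0 bridges the index shift. -/
theorem seqNorm_le_seqNorm_succ {E : Type*} [NormedAddCommGroup E] {p : ℝ≥0∞} (hp : 1 ≤ p)
    (N : ℕ) {v : ℕ → E} (h0 : v 0 = 0) : seqNorm p N v ≤ seqNorm p N fun n => v (n + 1) := by
  refine le_trans (seqNorm_mono hp fun n _ => ?_) (seqNorm_shift_le hp 1 fun n => v (n + 1))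
  cases n with
  | zero => simp [h0]
  | succ n => simp

end Estimate

end

/-! ### The maximal regularity estimate -/

theorem mainTheorem9 {X : Type*} [NormedAddCommGroup X] [NormedSpace ℂ X] [CompleteSpace X]
    (A : X →ₗ.[ℂ] X) (θ : ℝ) (hθ : Real.pi / 2 < θ) (hA : IsUniformlyBoundedOnSector A θ)
    {s : ℕ} (T : ButcherTableau s) (hord : T.HasOrderAtLeastOne) (hstab : T.IsAStable)
    (hinv : IsUnit T.a.det) (hinf : ‖T.stabInfty‖ < 1) :
    ∃ C : ℝ, 0 < C ∧ ∀ τ : ℝ, 0 < τ → ∀ f : ℝ → X,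
      (∃! w : (ℕ → X) × (ℕ → Fin s → A.domain), IsRKSolution A T τ f w.1 w.2) ∧
      ∀ (u : ℕ → X) (U : ℕ → Fin s → A.domain), IsRKSolution A T τ f u U →
        ∃ hu : ∀ n, u n ∈ A.domain,
          ∀ (N : ℕ), 2 ≤ N → ∀ p : ℝ≥0∞, 1 ≤ p →
            seqNorm p N (fun n => A ⟨u (n + 1), hu (n + 1)⟩) +
                seqNorm p N (fun n i => A (U n i)) ≤
              C * Real.log N * seqNorm p N (rkData T τ f) := by
  obtain ⟨S, Qi, hSQ, ⟨c, hc⟩, hpoly⟩ :=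
    hA.exists_uniform_stability_bound hθ T hord hstab hinv hinf
  choose b hb using hpoly
  obtain ⟨B₁, hB₁⟩ : ∃ B, B = ∑ i, ∑ j, |b (Polynomial.X * T.stageMatrix.adjugate i j)| :=
    ⟨_, rfl⟩
  obtain ⟨B₂, hB₂⟩ : ∃ B, B = ∑ i, ∑ j, ∑ k, |T.a j k| *
    |b ((Polynomial.X - 1) * T.stageMatrix.adjugate i j)| := ⟨_, rfl⟩
  have hB₁0 : 0 ≤ B₁ := by rw [hB₁]; positivity
  have hB₂0 : 0 ≤ B₂ := by rw [hB₂]; positivity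
  -- The bound for Au_{n+1} gives 3s|c|; the stages add B₁ times this, and B₂ doubled by 1 ≤ 2 log
  -- N. The final 1 ensures positivity.
  refine ⟨(1 + B₁) * (s * |c| * 3) + 2 * B₂ + 1, by positivity, fun τ hτ f => ?_⟩
  obtain ⟨hS, hQ, hQ'⟩ := hSQ τ hτ
  refine ⟨hS.existsUnique_isRKSolution hQ hQ' f, fun u U hu => ?_⟩
  have hd := hS.mem_domain_of_isRKSolution hQ hQ' hu
  obtain ⟨h0, hU, -⟩ := (hS.isRKSolution_iff hQ hQ' f u U).1 hu
  refine ⟨hd, fun N hN p hp => ?_⟩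
  obtain ⟨hlog1, hlog⟩ := sum_range_inv_le_log hN
  have hD : 0 ≤ seqNorm p N (rkData T τ f) := seqNorm_nonneg hp _
  have hconv : seqNorm p N (fun n => A ⟨u (n + 1), hd (n + 1)⟩) ≤
      s * |c| * 3 * Real.log N * seqNorm p N (rkData T τ f) := by
    refine (seqNorm_le_of_convolution hp (c := fun k => s * |c| * ((k : ℝ) + 1)⁻¹)
      (fun k => by positivity)
      (hS.norm_apply_le_sum hτ.ne' hQ hQ' hu hd (hc τ hτ))).trans ?_
    rw [← Finset.mul_sum, mul_assoc _ 3]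
    gcongr
  have hshift : seqNorm p N (fun n => A ⟨u n, hd n⟩) ≤
      seqNorm p N (fun n => A ⟨u (n + 1), hd (n + 1)⟩) := by
    refine seqNorm_le_seqNorm_succ hp N (v := fun n => A ⟨u n, hd n⟩) ?_
    rw [← A.map_zero]
    exact congrArg A (Subtype.ext h0)
  have hstage : seqNorm p N (fun n i => A (U n i)) ≤
      B₁ * seqNorm p N (fun n => A ⟨u n, hd n⟩) + B₂ * seqNorm p N (rkData T τ f) := by
    rw [← seqNorm_norm hp fun n => A ⟨u n, hd n⟩, ← seqNorm_norm hp (rkData T τ f),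
      ← seqNorm_const_mul hp hB₁0, ← seqNorm_const_mul hp hB₂0]
    refine le_trans (seqNorm_mono hp fun n _ => ?_) (seqNorm_add_le hp _ _)
    refine le_trans ?_ (le_abs_self _)
    rw [hB₁, hB₂]
    exact hS.norm_apply_stage_le hτ.ne' hQ hQ' ⟨u n, hd n⟩ (rkData T τ f n) (U n) (hU n)
      fun q => hb q τ hτ
  generalize seqNorm p N (rkData T τ f) = D at *
  generalize seqNorm p N (fun n => A ⟨u (n + 1), hd (n + 1)⟩) = V at *
  generalize seqNorm p N (fun n => A ⟨u n, hd n⟩) = W at *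
  have h1 : B₁ * W ≤ B₁ * (s * |c| * 3 * Real.log N * D) :=
    mul_le_mul_of_nonneg_left (hshift.trans hconv) hB₁0
  have h2 : B₂ * D * 1 ≤ B₂ * D * (2 * Real.log N) :=
    mul_le_mul_of_nonneg_left hlog1 (mul_nonneg hB₂0 hD)
  have h3 : 0 ≤ Real.log N * D := mul_nonneg (by linarith) hD
  linarith
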